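/- All graphs are finite and simple. A graph $H$ is a \emph{topological minor} of a graph $G$ if some subgraph of $G$ is a subdivision of $H$, that is, can be obtained from $H$ by replacing the edges of $H$ by internally disjoint paths. A graph $G$ is \emph{$(k,d)$-colourable} if each vertex can be assigned one of $k$ colours so that every vertex has at most $d$ neighbours of its own colour. It is \emph{$(k,d)$-choosable} if, for every assignment of a set $L(v)$ of exactly $k$ colours to each vertex $v$, one can choose a colour from $L(v)$ for each vertex $v$ so that every vertex has at most $d$ neighbours of its own colour. The \emph{defective chromatic number} (respectively, \emph{defective choice number}) of a class $\mathcal{C}$ of graphs is the minimum integer $k\geq 0$ for which there is an integer $d\geq 0$ such that every graph in $\mathcal{C}$ is $(k,d)$-colourable (respectively, $(k,d)$-choosable). \textbf{Theorem.} For all integers $t\geq s\geq 1$, the class of graphs that do not contain the complete bipartite graph $K_{s,t}$ as a topological minor has defective chromatic number equal to $s$ and defective choice number equal to $s$. Moreover, there is an absolute constant $C>0$ such that for all integers $t\geq s\geq 1$ there is an integer $d$ with $0\leq d\leq 2^{C s\log t}$ such that every graph with no $K_{s,t}$ topological minor is $(s,d)$-choosable. -/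

import Mathlib

universe u v

namespace DefectiveColouring

/-- The subgraph `S` of `G` is a subdivision of `H`: it is obtained from `H` by replacing each edge
`uv` by a path `P u v` between the branch vertices `f u` and `f v`, where the inner vertices of
the paths are not branch vertices and are not shared by the paths of two distinct edges. -/
def IsSubdivision {V : Type u} {W : Type v} {G : SimpleGraph V}
    (S : G.Subgraph) (H : SimpleGraph W) : Prop :=
  ∃ (f : W → V) (P : ∀ a b : W, H.Adj a b → G.Walk (f a) (f b)),
    Function.Injective f ∧
    (∀ a b (h : H.Adj a b), (P a b h).IsPath) ∧
    (∀ a b (h : H.Adj a b), P b a h.symm = (P a b h).reverse) ∧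
    (∀ a b (h : H.Adj a b) (w : W), f w ∈ (P a b h).support → w = a ∨ w = b) ∧
    (∀ a b (h : H.Adj a b) a' b' (h' : H.Adj a' b'), s(a, b) ≠ s(a', b') →
      ∀ x, x ∈ (P a b h).support → x ∈ (P a' b' h').support → x ∈ Set.range f) ∧
    (∀ x, x ∈ S.verts ↔
      x ∈ Set.range f ∨ ∃ a b, ∃ h : H.Adj a b, x ∈ (P a b h).support) ∧
    (∀ x y, S.Adj x y ↔ ∃ a b, ∃ h : H.Adj a b, s(x, y) ∈ (P a b h).edges)

/-- `H` is a topological minor of `G`: some subgraph of `G` is a subdivision of `H`. -/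
def IsTopologicalMinor {V : Type u} {W : Type v} (H : SimpleGraph W) (G : SimpleGraph V) : Prop :=
  ∃ S : G.Subgraph, IsSubdivision S H

/-- The colouring `c` of `G` has defect `d`: every vertex has at most `d` neighbours of its own
colour. -/
def HasDefect {V : Type u} {α : Type v} (G : SimpleGraph V) (c : V → α) (d : ℕ) : Prop :=
  ∀ x : V, {y | G.Adj x y ∧ c y = c x}.encard ≤ d

/-- `G` is `(k, d)`-colourable: `k`-colourable with defect `d`. -/
def IsColourable {V : Type u} (G : SimpleGraph V) (k d : ℕ) : Prop :=
  ∃ c : V → Fin k, HasDefect G c d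

/-- `G` is `(k, d)`-choosable: for every assignment `L` of lists of exactly `k` colours to the
vertices there is an `L`-colouring with defect `d`. -/
def IsChoosable {V : Type u} (G : SimpleGraph V) (k d : ℕ) : Prop :=
  ∀ (α : Type) (L : V → Finset α), (∀ x, (L x).card = k) →
    ∃ c : V → α, (∀ x, c x ∈ L x) ∧ HasDefect G c d

/-- A property of graphs. The class it stands for consists of the finite graphs that have it. -/
abbrev GraphClass : Type (u + 1) := ∀ V : Type u, SimpleGraph V → Prop

/-- `k` is the defective chromatic number of the class `𝒞` of finite graphs: the minimum `k` for
which there is some `d` such that every graph in `𝒞` is `(k, d)`-colourable. -/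
def IsDefectiveChromaticNumber (𝒞 : GraphClass.{u}) (k : ℕ) : Prop :=
  IsLeast {j : ℕ | ∃ d : ℕ, ∀ (V : Type u) [Finite V] (G : SimpleGraph V),
    𝒞 V G → IsColourable G j d} k

/-- `k` is the defective choice number of the class `𝒞` of finite graphs: the minimum `k` for
which there is some `d` such that every graph in `𝒞` is `(k, d)`-choosable. -/
def IsDefectiveChoiceNumber (𝒞 : GraphClass.{u}) (k : ℕ) : Prop :=
  IsLeast {j : ℕ | ∃ d : ℕ, ∀ (V : Type u) [Finite V] (G : SimpleGraph V),
    𝒞 V G → IsChoosable G j d} k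

/-- The graphs that do not have `K_{s,t}` as a topological minor. -/
def KstTopologicalMinorFree (s t : ℕ) : GraphClass.{u} :=
  fun _ G => ¬ IsTopologicalMinor (completeBipartiteGraph (Fin s) (Fin t)) G

end DefectiveColouring

namespace DefectiveColouring

open Finset
open scoped Classical

noncomputable section

variable {V : Type u}

/-! ### Reachability along walks -/

section Reachability

/-! Upper bound. A vertex of degree less than `s` can be coloured last, with a colour that its
neighbours do not use. An edge whose two ends have degree at most `d` can be dropped, because its
ends cannot exceed defect `d` in any case (`choosable_of_light`). So it suffices to find such a
light edge when every non-isolated vertex has degree at least `s` (`exists_light_edge`). If there is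
none, the set `A` of low-degree vertices is independent, with all its neighbours in the set `B` of
high-degree vertices. Let as many vertices of `A` as possible subdivide distinct edges of a graph
`D` on `B`. Like `G`, the graph `D` contains no subdivision of K_{s,t}, so it is sparse and has few
cliques on `s` vertices. The neighbours of an unused vertex of `A` form a clique of `D`, and at most
`t` such vertices can share a given `s`-clique. Hence `A` is at most a constant times larger than
`B`, and the degrees in `B` contradict the sparsity of `G`.

Sparsity means that average degree of order `s * t` forces a subdivision of K_{s,t}
(`exists_model_of_dense`). In a minimal dense subgraph fix branch vertices, and give each end of
each future path its own neighbour as a terminal. The rest, with the terminals, is a massed pair,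
and massed pairs are linked (`Massed.linked`). In a minimal counterexample to the latter every edge
inside `R` lies in many triangles and some vertex has small degree. The neighbourhood of that vertex
contains a robust set, in which few terminals can be joined by short disjoint connections, and
Menger's theorem carries a small boundary into it. Disjointness is encoded by labellings: different
label classes are disjoint automatically, so only reachability within a class has to be tracked.

Lower bound. In the closure of a tree with `s` levels two incomparable vertices are separated by
fewer than `s` common ancestors, whereas the branch vertices of a subdivided K_{s,t} are not. With
`d + 1` children at each inner vertex, any colouring of defect `d` uses `s` colours
(`treeClosure_free`, `treeClosure_not_colourable`). -/

theorem reachable_map_of_adj {W : Type v} {F : SimpleGraph V} {F' : SimpleGraph W} (π : V → W)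
    (h : ∀ a b, F.Adj a b → F'.Reachable (π a) (π b)) {x y : V} (hxy : F.Reachable x y) :
    F'.Reachable (π x) (π y) := by
  obtain ⟨p⟩ := hxy
  induction p with
  | nil => exact SimpleGraph.Reachable.refl _
  | cons hab _ ih => exact (h _ _ hab).trans ih

theorem reachable_of_adj {F F' : SimpleGraph V}
    (h : ∀ a b, F.Adj a b → F'.Reachable a b) {x y : V} (hxy : F.Reachable x y) :
    F'.Reachable x y := reachable_map_of_adj id h hxy

theorem eq_of_reachable {α : Type*} {F : SimpleGraph V} {l : V → α}
    (h : ∀ a b, F.Adj a b → l a = l b) {x y : V} (hxy : F.Reachable x y) : l x = l y := by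
  obtain ⟨p⟩ := hxy
  induction p with
  | nil => rfl
  | cons hab _ ih => exact (h _ _ hab).trans ih

theorem exists_adj_of_reachable_ne {F : SimpleGraph V} {x y : V} (hxy : F.Reachable x y)
    (hne : x ≠ y) : ∃ z, F.Adj x z := by
  obtain ⟨p⟩ := hxy
  cases p with
  | nil => exact absurd rfl hne
  | cons hab _ => exact ⟨_, hab⟩

end Reachability

/-! ### Linkages and Menger's theorem -/

/-- The edges of `G` within `S` whose ends have the same label. -/
def mono (G : SimpleGraph V) (S : Finset V) (l : V → ℕ) : SimpleGraph V where
  Adj a b := G.Adj a b ∧ a ∈ S ∧ b ∈ S ∧ l a = l b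
  symm := ⟨fun _ _ h => ⟨h.1.symm, h.2.2.1, h.2.1, h.2.2.2.symm⟩⟩
  loopless := ⟨fun _ h => h.1.ne rfl⟩

/-- `G` without the edges that meet `D`. -/
def avoid (G : SimpleGraph V) (D : Finset V) : SimpleGraph V where
  Adj a b := G.Adj a b ∧ a ∉ D ∧ b ∉ D
  symm := ⟨fun _ _ h => ⟨h.1.symm, h.2.2, h.2.1⟩⟩
  loopless := ⟨fun _ h => h.1.ne rfl⟩

theorem mono_mono {G G' : SimpleGraph V} (hG : G ≤ G') {S S' : Finset V} (hS : S ⊆ S')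
    (l : V → ℕ) : mono G S l ≤ mono G' S' l :=
  fun _ _ h => ⟨hG h.1, hS h.2.1, hS h.2.2.1, h.2.2.2⟩

/-- Every labelling of `Y` extends to `D ∪ Y` so that any two vertices of `Y` with the same label
are joined in `D ∪ Y` by a path of that label. -/
def Linked (G : SimpleGraph V) (D Y : Finset V) : Prop :=
  ∀ c : V → ℕ, ∃ l : V → ℕ, (∀ y ∈ Y, l y = c y) ∧
    ∀ x ∈ Y, ∀ y ∈ Y, c x = c y → (mono G (D ∪ Y) l).Reachable x y

theorem Linked.mono_left {G G' : SimpleGraph V} (h : G ≤ G') {D Y : Finset V}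
    (hL : Linked G D Y) : Linked G' D Y := fun c => by
  obtain ⟨l, h1, h2⟩ := hL c
  exact ⟨l, h1, fun x hx y hy hxy => (h2 x hx y hy hxy).mono (mono_mono h subset_rfl l)⟩

/-- The graph `P` consists of disjoint connected pieces in `E ∪ B` that join each vertex of `B` to
a vertex of `S`, and meets the target `T` only in `S`. -/
structure Linkage (G P : SimpleGraph V) (E T B S : Finset V) : Prop where
  le : P ≤ G
  verts : ∀ a b, P.Adj a b → a ∈ E ∪ B
  tgt : ∀ a b, P.Adj a b → a ∈ T → a ∈ S
  sub : S ⊆ T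
  card : S.card ≤ B.card
  reach : ∀ y ∈ B, ∃ z ∈ S, P.Reachable y z
  label : ∀ c : V → ℕ, ∃ l : V → ℕ, (∀ y ∈ B, l y = c y) ∧ ∀ a b, P.Adj a b → l a = l b

theorem Linkage.mem {G P : SimpleGraph V} {E T B S : Finset V} (h : Linkage G P E T B S)
    {a : V} (haB : a ∈ B) (haT : a ∈ T) : a ∈ S := by
  obtain ⟨z, hz, hr⟩ := h.reach a haB
  by_cases haz : a = z
  · exact haz ▸ hz
  · obtain ⟨w, hw⟩ := exists_adj_of_reachable_ne hr haz
    exact h.tgt a w hw haT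

variable [Fintype V]

/-- The outer boundary of `D`. -/
def bdry (G : SimpleGraph V) (D : Finset V) : Finset V :=
  univ.filter fun v => v ∉ D ∧ ∃ d ∈ D, G.Adj d v

/-- The number of ordered pairs of adjacent vertices that meet `D`. -/
def touch (G : SimpleGraph V) (D : Finset V) : ℕ :=
  (univ.filter fun p : V × V => G.Adj p.1 p.2 ∧ (p.1 ∈ D ∨ p.2 ∈ D)).card

/-- The vertices that separate `E` from its complement or lie in `T` outside `E`. -/
def sep (G : SimpleGraph V) (T E : Finset V) : Finset V := bdry G E ∪ (T \ E)

/-- The number of ordered pairs of adjacent vertices in `E`. -/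
def pairs (G : SimpleGraph V) (E : Finset V) : ℕ :=
  (univ.filter fun p : V × V => G.Adj p.1 p.2 ∧ p.1 ∈ E ∧ p.2 ∈ E).card

theorem mem_bdry {G : SimpleGraph V} {D : Finset V} {v : V} :
    v ∈ bdry G D ↔ v ∉ D ∧ ∃ d ∈ D, G.Adj d v := by simp [bdry]

theorem mem_sep {G : SimpleGraph V} {T E : Finset V} {v : V} :
    v ∈ sep G T E ↔ v ∉ E ∧ (v ∈ T ∨ ∃ d ∈ E, G.Adj d v) := by
  simp only [sep, mem_union, mem_bdry, mem_sdiff]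
  by_cases h : v ∈ E <;> simp [h, or_comm]

/-- Separators compose: after `E'` is discarded and its separator becomes the target, the separators
are still those of the original problem. This transfers minimality to the outer half in the
induction for Menger's theorem. -/
theorem sep_avoid {G : SimpleGraph V} {T E' E'' : Finset V} (h : Disjoint E' E'') :
    sep (avoid G E') (sep G T E') E'' = sep G T (E' ∪ E'') := by
  ext v
  rw [Finset.disjoint_left] at h
  simp only [mem_sep, avoid, mem_union]
  constructor
  · rintro ⟨h1, (⟨h2, h3⟩ | ⟨d, h2, h3, h4, h5⟩)⟩ <;> grind
  · rintro ⟨h1, (h2 | ⟨d, (h2 | h2), h3⟩)⟩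
    · grind
    · grind
    · refine ⟨by tauto, Or.inr ⟨d, h2, h3, fun hd => h hd h2, by tauto⟩⟩

/-- Follow a linkage onto the separator of `E'`, outside `E'`, by one from there to `T`. The second
labelling extends the first on that separator, the only place where the two can meet, so the pieces
stay disjoint. -/
theorem Linkage.comp {G P₁ P₂ : SimpleGraph V} {E E' T S₁ S₂ : Finset V} (hE : E' ⊆ E)
    (hc : (sep G T E').card ≤ (sep G T E).card)
    (h₁ : Linkage (avoid G E') P₁ (E \ E') (sep G T E') (sep G T E) S₁)
    (h₂ : Linkage G P₂ E' T (sep G T E') S₂) :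
    Linkage G (P₁ ⊔ P₂) E T (sep G T E) S₂ := by
  have hsep : ∀ a, a ∈ sep G T E' → a ∈ E ∪ sep G T E := by
    intro a ha
    simp only [mem_sep, mem_union] at ha ⊢
    by_cases haE : a ∈ E
    · exact Or.inl haE
    · obtain ⟨h1, (h2 | ⟨d, h2, h3⟩)⟩ := ha
      · exact Or.inr ⟨haE, Or.inl h2⟩
      · exact Or.inr ⟨haE, Or.inr ⟨d, hE h2, h3⟩⟩
  refine ⟨?_, ?_, ?_, h₂.sub, h₂.card.trans hc, ?_, ?_⟩
  · exact sup_le (fun a b h => (h₁.le h).1) h₂.le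
  · rintro a b (h | h)
    · have := h₁.verts a b h
      simp only [mem_union, mem_sdiff] at this ⊢; tauto
    · have := h₂.verts a b h
      simp only [mem_union] at this
      rcases this with h' | h'
      · exact mem_union_left _ (hE h')
      · exact hsep a h'
  · rintro a b (h | h) haT
    · exact h₂.mem (mem_sep.2 ⟨(h₁.le h).2.1, Or.inl haT⟩) haT
    · exact h₂.tgt a b h haT
  · intro y hy
    obtain ⟨z, hz, hyz⟩ := h₁.reach y hy
    obtain ⟨w, hw, hzw⟩ := h₂.reach z (h₁.sub hz)
    exact ⟨w, hw, (hyz.mono le_sup_left).trans (hzw.mono le_sup_right)⟩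
  · intro c
    obtain ⟨l₁, hl₁, hP₁⟩ := h₁.label c
    obtain ⟨l₂, hl₂, hP₂⟩ := h₂.label l₁
    have key : ∀ a, a ∉ E' → (if a ∈ E' ∪ sep G T E' then l₂ a else l₁ a) = l₁ a := by
      intro a ha
      split_ifs with h
      · exact hl₂ a ((mem_union.1 h).resolve_left ha)
      · rfl
    refine ⟨fun a => if a ∈ E' ∪ sep G T E' then l₂ a else l₁ a, ?_, ?_⟩
    · intro y hy
      have : y ∉ E' := fun h => (mem_sep.1 hy).1 (hE h)
      exact (key y this).trans (hl₁ y hy)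
    · rintro a b (h | h)
      · exact (key a (h₁.le h).2.1).trans ((hP₁ a b h).trans (key b (h₁.le h).2.2).symm)
      · simp only [if_pos (h₂.verts a b h), if_pos (h₂.verts b a h.symm), hP₂ a b h]

/-- Here linkages are matchings, so this is Hall's theorem. For a set `A'` of separator vertices
outside `T`, remove its neighbourhood `K` from `E`: then `A'` leaves the separator and, as `E` has
no edges, only `T ∩ K` enters. Minimality of the separator is Hall's condition. -/
theorem exists_linkage_of_no_edges {G : SimpleGraph V} {E T : Finset V}
    (hmin : ∀ E' ⊆ E, (sep G T E).card ≤ (sep G T E').card)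
    (hno : ∀ a ∈ E, ∀ b ∈ E, ¬ G.Adj a b) :
    ∃ P S, Linkage G P E T (sep G T E) S := by
  let N : {y // y ∈ sep G T E \ T} → Finset V := fun y => univ.filter fun v =>
    v ∈ E ∧ v ∈ T ∧ G.Adj y v
  have hall : ∀ s : Finset {y // y ∈ sep G T E \ T}, s.card ≤ (s.biUnion N).card := by
    intro A
    let A' : Finset V := A.image Subtype.val
    have hA' : A'.card = A.card := card_image_of_injective _ Subtype.val_injective
    let K : Finset V := E.filter fun v => ∃ y ∈ A', G.Adj y v
    have hA'sub : A' ⊆ sep G T E := by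
      intro y hy
      obtain ⟨⟨z, hz⟩, -, rfl⟩ := mem_image.1 hy
      exact (mem_sdiff.1 hz).1
    have hA'T : ∀ y ∈ A', y ∉ T := by
      intro y hy
      obtain ⟨⟨z, hz⟩, -, rfl⟩ := mem_image.1 hy
      exact (mem_sdiff.1 hz).2
    have hK : T ∩ K ⊆ A.biUnion N := by
      intro v hv
      obtain ⟨hvT, hvK⟩ := mem_inter.1 hv
      obtain ⟨hvE, y, hy, hyv⟩ := mem_filter.1 hvK
      obtain ⟨z, hz, rfl⟩ := mem_image.1 hy
      exact mem_biUnion.2 ⟨z, hz, by simp [N, hvE, hvT, hyv]⟩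
    have hsub : sep G T (E \ K) ⊆ (sep G T E \ A') ∪ (T ∩ K) := by
      intro v hv
      obtain ⟨hv1, hv2⟩ := mem_sep.1 hv
      by_cases hvE : v ∈ E
      · have hvK : v ∈ K := by by_contra h; exact hv1 (mem_sdiff.2 ⟨hvE, h⟩)
        rcases hv2 with h | ⟨d, hd, hdv⟩
        · exact mem_union_right _ (mem_inter.2 ⟨h, hvK⟩)
        · exact absurd hdv (hno d (mem_sdiff.1 hd).1 v hvE)
      · refine mem_union_left _ (mem_sdiff.2 ⟨mem_sep.2 ⟨hvE, ?_⟩, ?_⟩)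
        · rcases hv2 with h | ⟨d, hd, hdv⟩
          · exact Or.inl h
          · exact Or.inr ⟨d, (mem_sdiff.1 hd).1, hdv⟩
        · intro hvA
          rcases hv2 with h | ⟨d, hd, hdv⟩
          · exact hA'T v hvA h
          · exact (mem_sdiff.1 hd).2 (mem_filter.2 ⟨(mem_sdiff.1 hd).1, v, hvA, hdv.symm⟩)
    have h1 := (hmin (E \ K) sdiff_subset).trans (card_le_card hsub)
    have h2 := card_union_le (sep G T E \ A') (T ∩ K)
    have h3 := card_sdiff_add_card_eq_card hA'sub
    have h4 := card_le_card hK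
    omega
  obtain ⟨f, hfinj, hf⟩ := (all_card_le_biUnion_card_iff_exists_injective N).1 hall
  have hf' : ∀ y, f y ∈ E ∧ f y ∈ T ∧ G.Adj y (f y) := fun y => (mem_filter.1 (hf y)).2
  let P : SimpleGraph V :=
    { Adj := fun a b => (∃ h, f ⟨a, h⟩ = b) ∨ ∃ h, f ⟨b, h⟩ = a
      symm := ⟨fun a b h => h.symm⟩
      loopless := ⟨fun a h => by
        rcases h with ⟨h, h'⟩ | ⟨h, h'⟩ <;>
        · have := (hf' ⟨a, h⟩).2.2
          rw [h'] at this; exact this.ne rfl⟩ }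
  let S : Finset V := (sep G T E ∩ T) ∪ univ.image f
  refine ⟨P, S, ?_, ?_, ?_, ?_, ?_, ?_, ?_⟩
  · rintro a b (⟨h, rfl⟩ | ⟨h, rfl⟩)
    · exact (hf' ⟨a, h⟩).2.2
    · exact (hf' ⟨b, h⟩).2.2.symm
  · rintro a b (⟨h, rfl⟩ | ⟨h, rfl⟩)
    · exact mem_union_right _ (mem_sdiff.1 h).1
    · exact mem_union_left _ (hf' _).1
  · rintro a b (⟨h, rfl⟩ | ⟨h, rfl⟩) haT
    · exact absurd haT (mem_sdiff.1 h).2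
    · exact mem_union_right _ (mem_image_of_mem _ (mem_univ _))
  · intro z hz
    rcases mem_union.1 hz with h | h
    · exact (mem_inter.1 h).2
    · obtain ⟨y, -, rfl⟩ := mem_image.1 h
      exact (hf' y).2.1
  · have h1 := card_union_le (sep G T E ∩ T) (univ.image f)
    change S.card ≤ _ at h1
    have h2 : (univ.image f).card ≤ (sep G T E \ T).card := by
      refine card_image_le.trans ?_
      simp
    have h3 := card_inter_add_card_sdiff (sep G T E) T
    omega
  · intro y hy
    by_cases hyT : y ∈ T
    · exact ⟨y, mem_union_left _ (mem_inter.2 ⟨hy, hyT⟩), SimpleGraph.Reachable.refl _⟩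
    · refine ⟨f ⟨y, mem_sdiff.2 ⟨hy, hyT⟩⟩, mem_union_right _ (mem_image_of_mem _ (mem_univ _)), ?_⟩
      exact SimpleGraph.Adj.reachable (Or.inl ⟨_, rfl⟩)
  · intro c
    refine ⟨fun v => if h : ∃ y, f y = v then c h.choose else c v, ?_, ?_⟩
    · intro y hy
      have : ¬ ∃ z, f z = y := by
        rintro ⟨z, rfl⟩
        exact (mem_sep.1 hy).1 (hf' z).1
      simp [this]
    · have key : ∀ y : {y // y ∈ sep G T E \ T},
          (if h : ∃ z, f z = (y : V) then c h.choose else c y) =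
          (if h : ∃ z, f z = f y then c h.choose else c (f y)) := by
        intro y
        have h1 : ¬ ∃ z, f z = (y : V) := by
          rintro ⟨z, hz⟩
          exact (mem_sep.1 (mem_sdiff.1 y.2).1).1 (hz ▸ (hf' z).1)
        have h2 : ∃ z, f z = f y := ⟨y, rfl⟩
        rw [dif_neg h1, dif_pos h2, hfinj h2.choose_spec]
      rintro a b (⟨h, rfl⟩ | ⟨h, rfl⟩)
      · exact key ⟨a, h⟩
      · exact (key ⟨b, h⟩).symm

theorem pairs_mono {G G' : SimpleGraph V} (hG : G ≤ G') {E E' : Finset V} (hE : E ⊆ E') :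
    pairs G E ≤ pairs G' E' := by
  apply card_le_card
  intro p hp
  simp only [mem_filter, mem_univ, true_and] at hp ⊢
  exact ⟨hG hp.1, hE hp.2.1, hE hp.2.2⟩

/-- Menger's theorem. -/
theorem exists_linkage (G : SimpleGraph V) (E T : Finset V)
    (hmin : ∀ E' ⊆ E, (sep G T E).card ≤ (sep G T E').card) :
    ∃ P S, Linkage G P E T (sep G T E) S := by
  induction hn : E.card + pairs G E using Nat.strong_induction_on generalizing G E T with
  | _ n ih =>
  subst hn
  -- A tight proper part splits the problem at its separator. If there is none, every proper
  -- nonempty part has a separator larger by at least one, which pays for deleting an edge inside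
  -- `E`.
  by_cases htight : ∃ E' ⊆ E, E' ≠ ∅ ∧ E' ≠ E ∧ (sep G T E').card ≤ (sep G T E).card
  · obtain ⟨E', hE', hne, hne', hc⟩ := htight
    have hlt : E'.card < E.card := card_lt_card (hE'.ssubset_of_ne hne')
    have hlt' : (E \ E').card < E.card := by
      have := card_sdiff_add_card_eq_card hE'
      have := card_pos.2 (nonempty_iff_ne_empty.2 hne)
      omega
    obtain ⟨P₂, S₂, h₂⟩ := ih (E'.card + pairs G E')
      (by have := pairs_mono (le_refl G) hE'; omega) G E' T
      (fun E'' h => hc.trans (hmin E'' (h.trans hE'))) rfl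
    have hsep : ∀ E'' ⊆ E \ E', sep (avoid G E') (sep G T E') E'' = sep G T (E' ∪ E'') :=
      fun E'' h => sep_avoid (disjoint_of_subset_right h disjoint_sdiff)
    have hEE : E' ∪ E \ E' = E := union_sdiff_of_subset hE'
    have havoid : avoid G E' ≤ G := fun a b h => h.1
    obtain ⟨P₁, S₁, h₁⟩ := ih ((E \ E').card + pairs (avoid G E') (E \ E'))
      (by have := pairs_mono havoid (sdiff_subset : E \ E' ⊆ E); omega)
      (avoid G E') (E \ E') (sep G T E')
      (fun E'' h => by
        rw [hsep _ h, hsep _ subset_rfl, hEE]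
        exact hmin _ (union_subset hE' (h.trans sdiff_subset))) rfl
    rw [hsep _ subset_rfl, hEE] at h₁
    exact ⟨_, _, h₁.comp hE' hc h₂⟩
  · push Not at htight
    by_cases hedge : ∃ a ∈ E, ∃ b ∈ E, G.Adj a b
    · obtain ⟨a, ha, b, hb, hab⟩ := hedge
      obtain ⟨G', hadj⟩ : ∃ G' : SimpleGraph V, ∀ x y,
          G'.Adj x y ↔ G.Adj x y ∧ s(x, y) ≠ s(a, b) := ⟨G.deleteEdges {s(a, b)}, by simp⟩
      have hle : G' ≤ G := fun x y h => ((hadj x y).1 h).1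
      have hsame : sep G' T E = sep G T E := by
        ext v
        simp only [mem_sep, hadj]
        constructor
        · rintro ⟨h1, (h2 | ⟨d, h2, h3, -⟩)⟩
          · exact ⟨h1, Or.inl h2⟩
          · exact ⟨h1, Or.inr ⟨d, h2, h3⟩⟩
        · rintro ⟨h1, (h2 | ⟨d, h2, h3⟩)⟩
          · exact ⟨h1, Or.inl h2⟩
          · refine ⟨h1, Or.inr ⟨d, h2, h3, fun h => ?_⟩⟩
            rcases Sym2.eq_iff.1 h with ⟨-, h⟩ | ⟨-, h⟩
            · exact h1 (h ▸ hb)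
            · exact h1 (h ▸ ha)
      have hlt : pairs G' E < pairs G E := by
        apply card_lt_card
        refine ⟨fun p hp => ?_, fun hsub => ?_⟩
        · simp only [mem_filter, mem_univ, true_and] at hp ⊢
          exact ⟨hle hp.1, hp.2⟩
        · have := @hsub (a, b) (mem_filter.2 ⟨mem_univ _, hab, ha, hb⟩)
          simp only [mem_filter, mem_univ, true_and, hadj] at this
          exact this.1.2 rfl
      obtain ⟨P, S, h⟩ := ih (E.card + pairs G' E) (by omega) G' E T (by
        intro E' hE'
        rw [hsame]
        by_cases h0 : E' = ∅
        · have : sep G' T E' = sep G T E' := by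
            subst h0; ext v; simp [mem_sep]
          rw [this]; exact hmin E' hE'
        by_cases h1 : E' = E
        · rw [h1, hsame]
        have hlt := htight E' hE' (nonempty_iff_ne_empty.2 h0) h1
        have hsub : sep G T E' ⊆ insert (if a ∈ E' then b else a) (sep G' T E') := by
          intro v hv
          rw [mem_insert]
          obtain ⟨h2, (h3 | ⟨d, h3, h4⟩)⟩ := mem_sep.1 hv
          · exact Or.inr (mem_sep.2 ⟨h2, Or.inl h3⟩)
          · by_cases hd : s(d, v) = s(a, b)
            · left
              rcases Sym2.eq_iff.1 hd with ⟨rfl, rfl⟩ | ⟨rfl, rfl⟩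
              · rw [if_pos h3]
              · rw [if_neg h2]
            · exact Or.inr (mem_sep.2 ⟨h2, Or.inr ⟨d, h3, (hadj d v).2 ⟨h4, hd⟩⟩⟩)
        have := (card_le_card hsub).trans (card_insert_le _ _)
        omega) rfl
      rw [hsame] at h
      exact ⟨P, S, h.le.trans hle, h.verts, h.tgt, h.sub, h.card, h.reach, h.label⟩
    · push Not at hedge
      exact exists_linkage_of_no_edges hmin hedge

/-- Linkages to a target region that links all small subsets of `T`. -/
theorem linked_of_target {G G' : SimpleGraph V} (hle : G' ≤ G) {E T Q E₁ : Finset V}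
    (hmin : ∀ E' ⊆ E, (sep G' T E).card ≤ (sep G' T E').card)
    (htgt : ∀ S ⊆ T, S.card ≤ (sep G' T E).card → ∀ c : V → ℕ, ∃ l : V → ℕ, (∀ y ∈ S, l y = c y) ∧
      ∀ x ∈ S, ∀ y ∈ S, c x = c y → (mono G Q l).Reachable x y)
    (hQB : ∀ a ∈ Q, a ∈ sep G' T E → a ∈ T)
    (hQ : ∀ a ∈ Q, ∀ b, G'.Adj a b → a ∈ T)
    (hE : E ⊆ E₁ ∪ sep G' T E) (hQE : Q ⊆ E₁ ∪ sep G' T E) :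
    Linked G E₁ (sep G' T E) := by
  obtain ⟨P, S, h⟩ := exists_linkage G' E T hmin
  intro c
  obtain ⟨l₁, hl₁, hP⟩ := h.label c
  obtain ⟨l₂, hl₂, hr⟩ := htgt S h.sub h.card l₁
  set l : V → ℕ := fun a => if a ∈ Q then l₂ a else l₁ a with hl
  have hS : ∀ a, (a ∈ Q → a ∈ S) → l a = l₁ a := by
    intro a ha
    simp only [hl]
    split_ifs with haQ
    · exact hl₂ a (ha haQ)
    · rfl
  have hPl : P ≤ mono G (E₁ ∪ sep G' T E) l := by
    intro a b hab
    have hv : ∀ a b, P.Adj a b → a ∈ E₁ ∪ sep G' T E := fun a b hab => by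
      rcases mem_union.1 (h.verts a b hab) with h' | h'
      · exact hE h'
      · exact mem_union_right _ h'
    refine ⟨hle (h.le hab), hv a b hab, hv b a hab.symm, ?_⟩
    rw [hS a fun haQ => h.tgt a b hab (hQ a haQ b (h.le hab)),
      hS b fun hbQ => h.tgt b a hab.symm (hQ b hbQ a (h.le hab.symm)), hP a b hab]
  have hQl : mono G Q l₂ ≤ mono G (E₁ ∪ sep G' T E) l := by
    intro a b hab
    refine ⟨hab.1, hQE hab.2.1, hQE hab.2.2.1, ?_⟩
    simp only [hl, if_pos hab.2.1, if_pos hab.2.2.1, hab.2.2.2]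
  refine ⟨l, fun y hy => ?_, fun x hx y hy hxy => ?_⟩
  · rw [hS y fun hyQ => h.mem hy (hQB y hyQ hy), hl₁ y hy]
  · obtain ⟨x', hx', hxx⟩ := h.reach x hx
    obtain ⟨y', hy', hyy⟩ := h.reach y hy
    have : l₁ x' = l₁ y' := by
      rw [← eq_of_reachable hP hxx, ← eq_of_reachable hP hyy, hl₁ x hx, hl₁ y hy, hxy]
    exact (hxx.mono hPl).trans (((hr x' hx' y' hy' this).mono hQl).trans (hyy.mono hPl).symm)

end

/-! ### Massed pairs, rigid parts, torsos and contractions -/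

noncomputable section

variable {V : Type u} [Fintype V]

/-- The pair `(R, X)` is massed: `R` meets many edges, but no part of `R` with fewer than `|X|`
neighbours does. -/
structure Massed (Λ : ℕ) (G : SimpleGraph V) (R X : Finset V) : Prop where
  disj : Disjoint R X
  bdry_sub : bdry G R ⊆ X
  lt_touch : Λ * R.card < touch G R
  touch_le : ∀ D ⊆ R, (bdry G D).card < X.card → touch G D ≤ Λ * D.card

theorem bdry_disjoint (G : SimpleGraph V) (D : Finset V) : Disjoint D (bdry G D) := by
  rw [Finset.disjoint_left]
  intro a ha h
  exact (mem_bdry.1 h).1 ha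

theorem sep_empty (G : SimpleGraph V) (D : Finset V) : sep G ∅ D = bdry G D := by
  ext v; simp [mem_sep, mem_bdry]

theorem sep_avoid_bdry {G : SimpleGraph V} {D E : Finset V} (h : Disjoint D E) :
    sep (avoid G D) (bdry G D) E = bdry G (D ∪ E) := by
  rw [← sep_empty, sep_avoid h, sep_empty]

/-- Menger's theorem outside `D`, with target `bdry G D`: minimality gives disjoint connections from
the boundary of `E` to that of `D`, and the linkedness of `D` completes them. -/
theorem Linked.extend {G : SimpleGraph V} {D E : Finset V} (hD : Linked G D (bdry G D))
    (hDE : D ⊆ E) (hmin : ∀ E', D ⊆ E' → E' ⊆ E → (bdry G E).card ≤ (bdry G E').card) :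
    Linked G E (bdry G E) := by
  have hE : sep (avoid G D) (bdry G D) (E \ D) = bdry G E := by
    rw [sep_avoid_bdry disjoint_sdiff, union_sdiff_of_subset hDE]
  rw [← hE]
  have hbE : ∀ a ∈ bdry G D, a ∈ E ∪ bdry G E := by
    intro a ha
    obtain ⟨h1, d, hd, h2⟩ := mem_bdry.1 ha
    by_cases haE : a ∈ E
    · exact mem_union_left _ haE
    · exact mem_union_right _ (mem_bdry.2 ⟨haE, d, hDE hd, h2⟩)
  refine linked_of_target (G' := avoid G D) (Q := D ∪ bdry G D) (T := bdry G D) (fun a b h => h.1)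
    ?_ ?_ ?_ ?_ ?_ ?_
  · intro E' hE'
    rw [hE, sep_avoid_bdry (disjoint_of_subset_right hE' disjoint_sdiff)]
    exact hmin _ subset_union_left (union_subset hDE (hE'.trans sdiff_subset))
  · intro S hS _ c
    obtain ⟨l, h1, h2⟩ := hD c
    exact ⟨l, fun y hy => h1 y (hS hy), fun x hx y hy => h2 x (hS hx) y (hS hy)⟩
  · intro a ha ha'
    rw [hE] at ha'
    rcases mem_union.1 ha with h | h
    · exact absurd (hDE h) (mem_bdry.1 ha').1
    · exact h
  · intro a ha b hab
    exact (mem_union.1 ha).resolve_left hab.2.1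
  · exact sdiff_subset.trans subset_union_left
  · rw [hE]
    exact union_subset (hDE.trans subset_union_left) hbE

/-- `G` with the edges at `D` replaced by a clique on the boundary of `D`. -/
def torso (G : SimpleGraph V) (D : Finset V) : SimpleGraph V where
  Adj a b := a ≠ b ∧ ((G.Adj a b ∧ a ∉ D ∧ b ∉ D) ∨ (a ∈ bdry G D ∧ b ∈ bdry G D))
  symm := ⟨fun _ _ h => ⟨h.1.symm, h.2.imp (fun h => ⟨h.1.symm, h.2.2, h.2.1⟩) And.symm⟩⟩
  loopless := ⟨fun _ h => h.1 rfl⟩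

theorem torso_notMem {G : SimpleGraph V} {D : Finset V} {a b : V} (h : (torso G D).Adj a b) :
    a ∉ D := by
  rcases h.2 with h | h
  · exact h.2.1
  · exact (mem_bdry.1 h.1).1

/-- A torso edge within `bdry G D` between equal labels is replaced by a path of that label through
`D`. The labels on `D` come from linking `D` for the labelling already found on its boundary. -/
theorem Linked.glue {G : SimpleGraph V} {D D' Y : Finset V} (hD : Linked G D (bdry G D))
    (hD' : Linked (torso G D) D' Y) (hsub : bdry G D ⊆ D' ∪ Y) (hdisj : ∀ a ∈ D, a ∉ D' ∪ Y) :
    Linked G (D ∪ D') Y := by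
  intro c
  obtain ⟨l', hl', hr'⟩ := hD' c
  obtain ⟨l₂, hl₂, hr₂⟩ := hD l'
  set l : V → ℕ := fun a => if a ∈ D then l₂ a else l' a with hl
  have h1 : ∀ a, a ∉ D → l a = l' a := fun a ha => if_neg ha
  have h2 : ∀ a, a ∈ D ∪ bdry G D → l a = l₂ a := by
    intro a ha
    by_cases haD : a ∈ D
    · exact if_pos haD
    · rw [h1 a haD, hl₂ a ((mem_union.1 ha).resolve_left haD)]
  have hle : mono G (D ∪ bdry G D) l₂ ≤ mono G (D ∪ D' ∪ Y) l := by
    intro a b hab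
    have : D ∪ bdry G D ⊆ D ∪ D' ∪ Y := by
      rw [union_assoc]; exact union_subset_union subset_rfl hsub
    refine ⟨hab.1, this hab.2.1, this hab.2.2.1, ?_⟩
    rw [h2 a hab.2.1, h2 b hab.2.2.1, hab.2.2.2]
  refine ⟨l, fun y hy => ?_, fun x hx y hy hxy => ?_⟩
  · rw [h1 y fun h => hdisj y h (mem_union_right _ hy), hl' y hy]
  · refine reachable_of_adj (fun a b hab => ?_) (hr' x hx y hy hxy)
    obtain ⟨⟨hne, hab' | hab'⟩, ha, hb, hlab⟩ := hab
    · refine SimpleGraph.Adj.reachable ⟨hab'.1, ?_, ?_, ?_⟩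
      · rw [union_assoc]; exact mem_union_right _ ha
      · rw [union_assoc]; exact mem_union_right _ hb
      · rw [h1 a hab'.2.1, h1 b hab'.2.2, hlab]
    · exact (hr₂ a hab'.1 b hab'.2 hlab).mono hle

theorem Massed.of_minimal {Λ : ℕ} {G : SimpleGraph V} {D : Finset V}
    (h₁ : Λ * D.card < touch G D)
    (h₂ : ∀ D' ⊆ D, (bdry G D').card < (bdry G D).card → touch G D' ≤ Λ * D'.card) :
    Massed Λ G D (bdry G D) :=
  ⟨bdry_disjoint G D, subset_rfl, h₁, h₂⟩

/-- With a smaller boundary, `R` itself would be subject to `touch_le`, against `lt_touch`. -/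
theorem Massed.bdry_eq {Λ : ℕ} {G : SimpleGraph V} {R X : Finset V} (hM : Massed Λ G R X) :
    bdry G R = X := by
  refine eq_of_subset_of_card_le hM.bdry_sub ?_
  by_contra h
  exact absurd (hM.touch_le R subset_rfl (not_le.1 h)) (not_le.2 hM.lt_touch)

/-- If some part of `R` with at most `n` neighbours meets many edges and fails the bound, then a
smallest one is massed. -/
theorem exists_massed {Λ n : ℕ} {G : SimpleGraph V} {R : Finset V}
    (h : ¬ ∀ D ⊆ R, (bdry G D).card < n → touch G D ≤ Λ * D.card) :
    ∃ D ⊆ R, (bdry G D).card < n ∧ Λ * D.card < touch G D ∧ Massed Λ G D (bdry G D) := by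
  push Not at h
  obtain ⟨D₀, h1, h2, h3⟩ := h
  obtain ⟨D, hD, hmin⟩ := exists_min_image
    (R.powerset.filter fun D => (bdry G D).card < n ∧ Λ * D.card < touch G D) card
    ⟨D₀, mem_filter.2 ⟨mem_powerset.2 h1, h2, h3⟩⟩
  obtain ⟨hDR, hD1, hD2⟩ := mem_filter.1 hD
  rw [mem_powerset] at hDR
  refine ⟨D, hDR, hD1, hD2, Massed.of_minimal hD2 fun D' hD' hlt => ?_⟩
  by_contra hcon
  have hle := hmin D' (mem_filter.2 ⟨mem_powerset.2 (hD'.trans hDR), hlt.trans hD1, not_le.1 hcon⟩)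
  rw [eq_of_subset_of_card_le hD' hle] at hlt
  exact lt_irrefl _ hlt

/-- The part `D` obeys the density bound, so the excess of edges survives outside `D`. Take a
smallest part `D'` violating the bound in the torso. If it meets `bdry G D`, which is a clique
there, then all of `bdry G D` lies in `D'` or its boundary, and gluing makes `D ∪ D'` linked,
against maximality. Otherwise `D'` already violates the bound in `G`. -/
theorem Massed.torso {Λ m : ℕ} {G : SimpleGraph V} {R X D : Finset V}
    (ih : ∀ (G' : SimpleGraph V) (R' X' : Finset V), R'.card < R.card → X'.card ≤ m →
      Massed Λ G' R' X' → Linked G' R' X')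
    (hM : Massed Λ G R X) (hX : X.card ≤ m) (hDR : D ⊆ R) (hD0 : D.Nonempty)
    (hDX : (bdry G D).card < X.card) (hL : Linked G D (bdry G D))
    (hmax : ∀ D' ⊆ R, D ⊆ D' → D'.Nonempty → (bdry G D').card ≤ X.card →
      Linked G D' (bdry G D') → D' = D) :
    Massed Λ (torso G D) (R \ D) X := by
  have hcard := card_sdiff_add_card_eq_card hDR
  have hD0' := card_pos.2 hD0
  refine ⟨disjoint_of_subset_left sdiff_subset hM.disj, ?_, ?_, ?_⟩
  · intro v hv
    obtain ⟨h1, d, hd, hdv⟩ := mem_bdry.1 hv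
    have hvR : v ∉ R := fun h => h1 (mem_sdiff.2 ⟨h, torso_notMem hdv.symm⟩)
    rcases hdv.2 with h | h
    · exact hM.bdry_sub (mem_bdry.2 ⟨hvR, d, (mem_sdiff.1 hd).1, h.1⟩)
    · obtain ⟨-, d', hd', h'⟩ := mem_bdry.1 h.2
      exact hM.bdry_sub (mem_bdry.2 ⟨hvR, d', hDR hd', h'⟩)
  · have h1 : touch G R ≤ touch G D + touch (DefectiveColouring.torso G D) (R \ D) := by
      refine (card_le_card ?_).trans (card_union_le _ _)
      intro p hp
      simp only [mem_union, mem_filter, mem_univ, true_and, mem_sdiff] at hp ⊢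
      by_cases hp1 : p.1 ∈ D
      · exact Or.inl ⟨hp.1, Or.inl hp1⟩
      by_cases hp2 : p.2 ∈ D
      · exact Or.inl ⟨hp.1, Or.inr hp2⟩
      · exact Or.inr ⟨⟨hp.1.ne, Or.inl ⟨hp.1, hp1, hp2⟩⟩, by tauto⟩
    have h2 := hM.touch_le D hDR hDX
    have h3 := hM.lt_touch
    rw [← hcard, mul_add] at h3
    omega
  · by_contra hcon
    obtain ⟨D', hD'R, hD'1, hD'2, hD'M⟩ := exists_massed hcon
    have hlt : D'.card < R.card := by have := card_le_card hD'R; omega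
    by_cases hx : ∃ x, x ∈ D' ∧ x ∈ bdry G D
    · obtain ⟨x, hxD', hxD⟩ := hx
      have hL' := ih _ _ _ hlt (hD'1.le.trans hX) hD'M
      have hsub : bdry G D ⊆ D' ∪ bdry (DefectiveColouring.torso G D) D' := by
        intro y hy
        by_cases hyD' : y ∈ D'
        · exact mem_union_left _ hyD'
        · refine mem_union_right _ (mem_bdry.2 ⟨hyD', x, hxD', ?_, Or.inr ⟨hxD, hy⟩⟩)
          rintro rfl; exact hyD' hxD'
      have hdisj : ∀ a ∈ D, a ∉ D' ∪ bdry (DefectiveColouring.torso G D) D' := by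
        intro a ha h
        rcases mem_union.1 h with h | h
        · exact (mem_sdiff.1 (hD'R h)).2 ha
        · obtain ⟨-, d, hd, hda⟩ := mem_bdry.1 h
          exact torso_notMem hda.symm ha
      have hglue := hL.glue hL' hsub hdisj
      have heq : bdry G (D ∪ D') = bdry (DefectiveColouring.torso G D) D' := by
        ext v
        constructor
        · intro hv
          obtain ⟨h1, d, hd, hdv⟩ := mem_bdry.1 hv
          rw [mem_union, not_or] at h1
          rcases mem_union.1 hd with h | h
          · exact (mem_union.1 (hsub (mem_bdry.2 ⟨h1.1, d, h, hdv⟩))).resolve_left h1.2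
          · exact mem_bdry.2 ⟨h1.2, d, h, hdv.ne,
              Or.inl ⟨hdv, (mem_sdiff.1 (hD'R h)).2, h1.1⟩⟩
        · intro hv
          have hvD : v ∉ D := fun h => hdisj v h (mem_union_right _ hv)
          obtain ⟨h1, d, hd, hdv⟩ := mem_bdry.1 hv
          rcases hdv.2 with h | h
          · exact mem_bdry.2 ⟨by simp [hvD, h1], d, mem_union_right _ hd, h.1⟩
          · obtain ⟨-, d', hd', h'⟩ := mem_bdry.1 h.2
            exact mem_bdry.2 ⟨by simp [hvD, h1], d', mem_union_left _ hd', h'⟩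
      rw [← heq] at hglue hD'1
      have := hmax (D ∪ D') (union_subset hDR (hD'R.trans sdiff_subset)) subset_union_left
        (hD0.mono subset_union_left) hD'1.le hglue
      exact (mem_bdry.1 hxD).1 (this ▸ mem_union_right D hxD')
    · push Not at hx
      have h1 : bdry G D' ⊆ bdry (DefectiveColouring.torso G D) D' := by
        intro v hv
        obtain ⟨h1, d, hd, hdv⟩ := mem_bdry.1 hv
        have hdD := (mem_sdiff.1 (hD'R hd)).2
        refine mem_bdry.2 ⟨h1, d, hd, hdv.ne, Or.inl ⟨hdv, hdD, fun hvD => ?_⟩⟩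
        exact hx d hd (mem_bdry.2 ⟨hdD, v, hvD, hdv.symm⟩)
      have h2 : touch (DefectiveColouring.torso G D) D' ≤ touch G D' := by
        apply card_le_card
        intro p hp
        simp only [mem_filter, mem_univ, true_and] at hp ⊢
        refine ⟨?_, hp.2⟩
        rcases hp.1.2 with h | h
        · exact h.1
        · rcases hp.2 with h' | h'
          · exact absurd h.1 (hx _ h')
          · exact absurd h.2 (hx _ h')
      have h3 := hM.touch_le D' (hD'R.trans sdiff_subset) ((card_le_card h1).trans_lt hD'1)
      omega

/-- A linked part of `R` with at most `|X|` neighbours makes `(R, X)` linked. -/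
theorem Massed.linked_of_rigid {Λ m : ℕ} {G : SimpleGraph V} {R X D : Finset V}
    (ih : ∀ (G' : SimpleGraph V) (R' X' : Finset V), R'.card < R.card → X'.card ≤ m →
      Massed Λ G' R' X' → Linked G' R' X')
    (hM : Massed Λ G R X) (hX : X.card ≤ m) (hDR : D ⊆ R) (hD0 : D.Nonempty)
    (hDX : (bdry G D).card ≤ X.card) (hL : Linked G D (bdry G D)) : Linked G R X := by
  obtain ⟨A, hA, hAmax⟩ := exists_max_image (R.powerset.filter fun D => D.Nonempty ∧
    (bdry G D).card ≤ X.card ∧ Linked G D (bdry G D)) card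
    ⟨D, mem_filter.2 ⟨mem_powerset.2 hDR, hD0, hDX, hL⟩⟩
  obtain ⟨hAR, hA0, hAX, hAL⟩ := mem_filter.1 hA
  rw [mem_powerset] at hAR
  have hmax : ∀ D' ⊆ R, A ⊆ D' → D'.Nonempty → (bdry G D').card ≤ X.card →
      Linked G D' (bdry G D') → D' = A := by
    intro D' h1 h2 h3 h4 h5
    exact (eq_of_subset_of_card_le h2
      (hAmax D' (mem_filter.2 ⟨mem_powerset.2 h1, h3, h4, h5⟩))).symm
  -- The set `E` of least boundary above the largest linked part `A` is linked by `Linked.extend`,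
  -- so it equals `A`. Thus no larger part of `R` has a smaller boundary than `A`.
  obtain ⟨E, hE, hEmin⟩ := exists_min_image (R.powerset.filter fun E => A ⊆ E)
    (fun E => (bdry G E).card) ⟨A, mem_filter.2 ⟨mem_powerset.2 hAR, subset_rfl⟩⟩
  obtain ⟨hER, hAE⟩ := mem_filter.1 hE
  rw [mem_powerset] at hER
  have hmin : ∀ E' ⊆ R, A ⊆ E' → (bdry G E).card ≤ (bdry G E').card :=
    fun E' h1 h2 => hEmin E' (mem_filter.2 ⟨mem_powerset.2 h1, h2⟩)
  have hEL := hAL.extend hAE fun E' h1 h2 => hmin E' (h2.trans hER) h1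
  have hEA : E = A := hmax E hER hAE (hA0.mono hAE) ((hmin A hAR subset_rfl).trans hAX) hEL
  subst hEA
  rcases hAX.lt_or_eq with hlt | heq
  · have hT := hM.torso ih hX hAR hA0 hlt hAL hmax
    have hcard := card_sdiff_add_card_eq_card hAR
    have hA0' := card_pos.2 hA0
    have hLT := ih _ _ _ (by omega) hX hT
    have := hAL.glue hLT (by
      intro v hv
      obtain ⟨h1, d, hd, hdv⟩ := mem_bdry.1 hv
      by_cases hvR : v ∈ R
      · exact mem_union_left _ (mem_sdiff.2 ⟨hvR, h1⟩)
      · exact mem_union_right _ (hM.bdry_sub (mem_bdry.2 ⟨hvR, d, hAR hd, hdv⟩))) (by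
      intro a ha h
      rcases mem_union.1 h with h | h
      · exact (mem_sdiff.1 h).2 ha
      · exact (Finset.disjoint_left.1 hM.disj) (hAR ha) h)
    rwa [union_sdiff_of_subset hAR] at this
  · have := hAL.extend hAR fun E' h1 h2 => by
      rw [hM.bdry_eq, ← heq]; exact hmin E' h2 h1
    rwa [hM.bdry_eq] at this

/-- `G` with the edge `uv` contracted to `u`. -/
def contract (G : SimpleGraph V) (u v : V) : SimpleGraph V where
  Adj a b := a ≠ b ∧ a ≠ v ∧ b ≠ v ∧ (G.Adj a b ∨ (a = u ∧ G.Adj v b) ∨ (b = u ∧ G.Adj v a))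
  symm := ⟨fun _ _ h => ⟨h.1.symm, h.2.2.1, h.2.1, h.2.2.2.imp SimpleGraph.Adj.symm Or.symm⟩⟩
  loopless := ⟨fun _ h => h.1 rfl⟩

/-- The vertex `v` takes the label of `u`, and every edge created by the contraction is routed
through `uv`. -/
theorem Linked.of_contract {V : Type u} {G : SimpleGraph V} {u v : V} {D Y : Finset V} (huv : G.Adj u v)
    (hu : u ∈ D) (hvY : v ∉ Y) (hL : Linked (contract G u v) D Y) :
    Linked G (insert v D) Y := by
  intro c
  obtain ⟨l', hl', hr'⟩ := hL c
  set l : V → ℕ := fun a => if a = v then l' u else l' a with hl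
  have h1 : ∀ a, a ≠ v → l a = l' a := fun a ha => if_neg ha
  have h2 : l v = l' u := if_pos rfl
  have hsub : D ∪ Y ⊆ insert v D ∪ Y := union_subset_union (subset_insert _ _) subset_rfl
  have hv : v ∈ insert v D ∪ Y := mem_union_left _ (mem_insert_self _ _)
  have huv' : (mono G (insert v D ∪ Y) l).Adj u v :=
    ⟨huv, hsub (mem_union_left _ hu), hv, by rw [h1 u huv.ne, h2]⟩
  refine ⟨l, fun y hy => ?_, fun x hx y hy hxy => ?_⟩
  · rw [h1 y (fun h => hvY (h ▸ hy)), hl' y hy]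
  · refine reachable_of_adj (fun a b hab => ?_) (hr' x hx y hy hxy)
    obtain ⟨⟨hne, hav, hbv, h⟩, ha, hb, hlab⟩ := hab
    rcases h with h | ⟨rfl, h⟩ | ⟨rfl, h⟩
    · exact SimpleGraph.Adj.reachable ⟨h, hsub ha, hsub hb, by rw [h1 a hav, h1 b hbv, hlab]⟩
    · refine huv'.reachable.trans (SimpleGraph.Adj.reachable ⟨h, hv, hsub hb, ?_⟩)
      rw [h2, h1 b hbv, hlab]
    · refine (huv'.reachable.trans (SimpleGraph.Adj.reachable ⟨h, hv, hsub ha, ?_⟩)).symm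
      rw [h2, h1 a hav, hlab]

end

/-! ### Robust sets in dense graphs -/

noncomputable section

variable {V : Type u}

/-- The neighbours of `x` in `S`. -/
def nbrIn (G : SimpleGraph V) (S : Finset V) (x : V) : Finset V := S.filter fun y => G.Adj x y

theorem mem_nbrIn {G : SimpleGraph V} {S : Finset V} {x y : V} :
    y ∈ nbrIn G S x ↔ y ∈ S ∧ G.Adj x y := by simp [nbrIn]

/-- Any two vertices of `U` are joined by a path in `U` on at most six vertices that avoids a given
set of at most `K` further vertices. -/
def Robust (G : SimpleGraph V) (K : ℕ) (U : Finset V) : Prop :=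
  ∀ Z : Finset V, Z.card ≤ K → ∀ x ∈ U, ∀ y ∈ U, x ∉ Z → y ∉ Z →
    ∃ N ⊆ U \ Z, N.card ≤ 6 ∧ x ∈ N ∧ y ∈ N ∧ (mono G N fun _ => 0).Reachable x y

/-- Each vertex of `S` is joined to a representative of its colour, one vertex at a time, by a short
path avoiding everything used before except its own ends. -/
theorem Robust.link {G : SimpleGraph V} {K : ℕ} {U S : Finset V} (hU : Robust G K U)
    (hS : S ⊆ U) (hK : 7 * S.card ≤ K) (c : V → ℕ) :
    ∃ l : V → ℕ, (∀ y ∈ S, l y = c y) ∧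
      ∀ x ∈ S, ∀ y ∈ S, c x = c y → (mono G U l).Reachable x y := by
  -- The chosen representative depends only on the colour, so joining every `x` to `r x` joins all
  -- vertices of equal colour.
  let r : V → V := fun x => if h : ∃ s ∈ S, c s = c x then h.choose else x
  have hr : ∀ x ∈ S, r x ∈ S ∧ c (r x) = c x := by
    intro x hx
    have h : ∃ s ∈ S, c s = c x := ⟨x, hx, rfl⟩
    simp only [r, dif_pos h]
    exact h.choose_spec
  have hrr : ∀ x ∈ S, ∀ y ∈ S, c x = c y → r x = r y := by
    intro x hx y hy hxy
    have h : ∃ s ∈ S, c s = c x := ⟨x, hx, rfl⟩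
    have h' : ∃ s ∈ S, c s = c y := ⟨y, hy, rfl⟩
    simp only [r, dif_pos h, dif_pos h']
    simp only [hxy]
  -- `W` collects the vertices already used. Each path adds at most six to the initial `S`, so `W`
  -- never exceeds `7 * S.card`.
  have key : ∀ A ⊆ S, ∃ (l : V → ℕ) (W : Finset V), S ⊆ W ∧ W ⊆ U ∧
      W.card ≤ S.card + 6 * A.card ∧ (∀ y ∈ S, l y = c y) ∧
      ∀ x ∈ A, (mono G W l).Reachable x (r x) := by
    intro A
    induction A using Finset.induction_on with
    | empty => exact fun _ => ⟨c, S, subset_rfl, hS, by simp, fun _ _ => rfl, by simp⟩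
    | insert a A haA ih =>
      intro hA
      obtain ⟨l, W, h1, h2, h3, h4, h5⟩ := ih ((subset_insert _ _).trans hA)
      have haS : a ∈ S := hA (mem_insert_self _ _)
      have hAS : A.card + 1 ≤ S.card := by
        rw [← card_insert_of_notMem haA]; exact card_le_card hA
      obtain ⟨N, hN, hN6, haN, hrN, hreach⟩ := hU (W \ {a, r a})
        ((card_le_card sdiff_subset).trans (by omega)) a (hS haS) (r a) (hS (hr a haS).1)
        (by simp) (by simp)
      have hNW : ∀ x ∈ N, x ∈ W → l x = c a := by
        intro x hxN hxW
        have := (mem_sdiff.1 (hN hxN)).2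
        have hx : x = a ∨ x = r a := by
          by_contra h
          exact this (mem_sdiff.2 ⟨hxW, by simpa using h⟩)
        rcases hx with rfl | rfl
        · exact h4 x haS
        · rw [h4 _ (hr a haS).1, (hr a haS).2]
      have hl : ∀ x ∈ W, (if x ∈ N then c a else l x) = l x := by
        intro x hx
        split_ifs with h
        · exact (hNW x h hx).symm
        · rfl
      have hle : mono G W l ≤ mono G (W ∪ N) fun x => if x ∈ N then c a else l x := by
        intro x y h
        refine ⟨h.1, mem_union_left _ h.2.1, mem_union_left _ h.2.2.1, ?_⟩
        exact (hl x h.2.1).trans (h.2.2.2.trans (hl y h.2.2.1).symm)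
      have hle' : (mono G N fun _ => 0) ≤ mono G (W ∪ N) fun x => if x ∈ N then c a else l x := by
        intro x y h
        refine ⟨h.1, mem_union_right _ h.2.1, mem_union_right _ h.2.2.1, ?_⟩
        exact (if_pos h.2.1).trans (if_pos h.2.2.1).symm
      refine ⟨_, W ∪ N, h1.trans subset_union_left, union_subset h2 (hN.trans sdiff_subset), ?_,
        fun y hy => (hl y (h1 hy)).trans (h4 y hy), ?_⟩
      · have := card_union_le W N
        rw [card_insert_of_notMem haA]
        omega
      · intro x hx
        rcases mem_insert.1 hx with rfl | hx
        · exact hreach.mono hle'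
        · exact (h5 x hx).mono hle
  obtain ⟨l, W, h1, h2, h3, h4, h5⟩ := key S subset_rfl
  refine ⟨l, h4, fun x hx y hy hxy => ?_⟩
  have := (h5 x hx).trans ((hrr x hx y hy hxy) ▸ (h5 y hy).symm)
  exact this.mono (mono_mono le_rfl h2 l)

theorem reachable_support {F G : SimpleGraph V} (hFG : F ≤ G) {x y : V} (p : F.Walk x y)
    (N : Finset V) (hN : ∀ v ∈ p.support, v ∈ N) : (mono G N fun _ => 0).Reachable x y := by
  induction p with
  | nil => exact SimpleGraph.Reachable.refl _
  | cons h p ih =>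
    have h1 := hN _ (SimpleGraph.Walk.start_mem_support _)
    have h2 := hN _ (List.mem_cons_of_mem _ (SimpleGraph.Walk.start_mem_support p))
    refine (SimpleGraph.Adj.reachable (G := mono G N fun _ => 0) ⟨hFG h, h1, h2, rfl⟩).trans
      (ih fun v hv => ?_)
    exact hN v (List.mem_cons_of_mem _ hv)

/-- Two neighbourhoods of size at least `d` among at most `n` vertices share more than `K` vertices,
so a common neighbour survives the removal of `Z`. -/
theorem robust_of_common {G : SimpleGraph V} {K n d : ℕ} {U : Finset V} (hn : U.card ≤ n)
    (hd : ∀ x ∈ U, d ≤ (nbrIn G U x).card) (h : n + K < 2 * d) : Robust G K U := by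
  intro Z hZ x hx y hy hxZ hyZ
  have h1 := card_union_add_card_inter (nbrIn G U x) (nbrIn G U y)
  have h2 : (nbrIn G U x ∪ nbrIn G U y).card ≤ U.card :=
    card_le_card (union_subset (filter_subset _ _) (filter_subset _ _))
  have h3 := hd x hx
  have h4 := hd y hy
  obtain ⟨w, hw, hwZ⟩ := exists_mem_notMem_of_card_lt_card
    (show Z.card < (nbrIn G U x ∩ nbrIn G U y).card by omega)
  obtain ⟨hwx, hwy⟩ := mem_inter.1 hw
  rw [mem_nbrIn] at hwx hwy
  refine ⟨{x, w, y}, ?_, ?_, by simp, by simp, ?_⟩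
  · intro v hv
    simp only [mem_insert, mem_singleton] at hv
    rcases hv with rfl | rfl | rfl <;> simp [*]
  · have := card_le_three (a := x) (b := w) (c := y); omega
  · refine SimpleGraph.Reachable.trans (v := w) (SimpleGraph.Adj.reachable ⟨hwx.2, ?_, ?_, rfl⟩)
      (SimpleGraph.Adj.reachable ⟨hwy.2.symm, ?_, ?_, rfl⟩) <;> simp

/-- In a dense graph, any two connected vertices are joined by a short walk. -/
theorem exists_short_walk {F : SimpleGraph V} {S : Finset V} {d : ℕ}
    (hF : ∀ a b, F.Adj a b → a ∈ S) (hd : ∀ x ∈ S, d ≤ (nbrIn F S x).card)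
    (hS : S.card < 3 * (d + 1)) {x y : V} (hx : x ∈ S) (hxy : F.Reachable x y) :
    ∃ p : F.Walk x y, p.length ≤ 5 := by
  obtain ⟨p, hp⟩ := hxy.exists_walk_length_eq_dist
  refine ⟨p, ?_⟩
  by_contra hlen
  push Not at hlen
  have hmin : ∀ q : F.Walk x y, p.length ≤ q.length := fun q => hp ▸ SimpleGraph.dist_le q
  let B : ℕ → Finset V := fun i => insert (p.getVert i) (nbrIn F S (p.getVert i))
  have hmem : ∀ i, p.getVert i ∈ S := by
    intro i
    by_cases hi : p.getVert i = x
    · rwa [hi]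
    · obtain ⟨z, hz⟩ := exists_adj_of_reachable_ne (F := F)
        (SimpleGraph.Walk.reachable (p.take i)).symm hi
      exact hF _ z hz
  have hBS : ∀ i, B i ⊆ S := fun i =>
    insert_subset (hmem i) (filter_subset _ _)
  have hBc : ∀ i, d + 1 ≤ (B i).card := by
    intro i
    rw [card_insert_of_notMem fun h => (mem_nbrIn.1 h).2.ne rfl]
    exact Nat.succ_le_succ (hd _ (hmem i))
  have hB : ∀ i w, w ∈ B i → ∃ q : F.Walk (p.getVert i) w, q.length ≤ 1 := by
    intro i w hw
    rcases mem_insert.1 hw with rfl | h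
    · exact ⟨SimpleGraph.Walk.nil, by simp⟩
    · exact ⟨SimpleGraph.Walk.cons (mem_nbrIn.1 h).2 SimpleGraph.Walk.nil, by simp⟩
  have hdis : ∀ i j, i + 3 ≤ j → j ≤ p.length → Disjoint (B i) (B j) := by
    intro i j hij hj
    rw [Finset.disjoint_left]
    intro w hwi hwj
    obtain ⟨q₁, h₁⟩ := hB i w hwi
    obtain ⟨q₂, h₂⟩ := hB j w hwj
    have := hmin ((p.take i).append (q₁.append (q₂.reverse.append (p.drop j))))
    simp only [SimpleGraph.Walk.length_append, SimpleGraph.Walk.length_reverse,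
      SimpleGraph.Walk.take_length, SimpleGraph.Walk.drop_length] at this
    omega
  -- A shortest walk of length six or more would carry three disjoint closed neighbourhoods, around
  -- its vertices at positions 0, 3 and 6, which do not fit into `S`.
  have h03 := hdis 0 3 le_rfl (by omega)
  have h06 := hdis 0 6 (by omega) (by omega)
  have h36 := hdis 3 6 le_rfl (by omega)
  have h1 := card_union_of_disjoint h03
  have h2 := card_union_of_disjoint (disjoint_union_left.2 ⟨h06, h36⟩)
  have h3 := card_le_card (union_subset (union_subset (hBS 0) (hBS 3)) (hBS 6))
  have := hBc 0; have := hBc 3; have := hBc 6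
  omega

/-- If `H` stays connected whenever at most `K` vertices are removed, short walks make `H` itself
robust. Otherwise a removal splits it into two sides with no edges between them. The smaller side
has at most `n` vertices and loses at most `K` from each degree, so its vertices have many common
neighbours. -/
theorem exists_robust {G : SimpleGraph V} {n d K : ℕ} {H : Finset V} (hH0 : H.Nonempty)
    (hn : H.card ≤ 2 * n) (hd : ∀ x ∈ H, d ≤ (nbrIn G H x).card)
    (h₁ : 2 * n + 3 * K < 3 * (d + 1)) (h₂ : n + 3 * K < 2 * d) :
    ∃ U ⊆ H, U.Nonempty ∧ Robust G K U ∧ ∀ x ∈ U, d ≤ (nbrIn G U x).card + K := by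
  have hdZ : ∀ Z : Finset V, Z.card ≤ K → ∀ Q ⊆ H \ Z, ∀ x ∈ Q,
      (∀ y ∈ H \ Z, G.Adj x y → y ∈ Q) → d ≤ (nbrIn G Q x).card + K := by
    intro Z hZ Q hQ x hx hcl
    refine (hd x (mem_sdiff.1 (hQ hx)).1).trans ?_
    refine (card_le_card (t := nbrIn G Q x ∪ Z) fun y hy => ?_).trans
      ((card_union_le _ _).trans (Nat.add_le_add_left hZ _))
    obtain ⟨hyH, hxy⟩ := mem_nbrIn.1 hy
    by_cases hyZ : y ∈ Z
    · exact mem_union_right _ hyZ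
    · exact mem_union_left _ (mem_nbrIn.2 ⟨hcl y (mem_sdiff.2 ⟨hyH, hyZ⟩) hxy, hxy⟩)
  by_cases hcon : ∀ Z : Finset V, Z.card ≤ K → ∀ x ∈ H \ Z, ∀ y ∈ H \ Z,
      (mono G (H \ Z) fun _ => 0).Reachable x y
  · refine ⟨H, subset_rfl, hH0, ?_, fun x hx => (hd x hx).trans (Nat.le_add_right _ _)⟩
    intro Z hZ x hx y hy hxZ hyZ
    have hx' := mem_sdiff.2 ⟨hx, hxZ⟩
    obtain ⟨p, hp⟩ := exists_short_walk (F := mono G (H \ Z) fun _ => 0) (S := H \ Z)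
      (d := d - K) (fun a b h => h.2.1) (fun v hv => by
        have := hdZ Z hZ (H \ Z) subset_rfl v hv (fun _ h _ => h)
        have heq : nbrIn (mono G (H \ Z) fun _ => 0) (H \ Z) v = nbrIn G (H \ Z) v := by
          ext w
          simp only [mem_nbrIn, mono, and_true]
          tauto
        rw [heq]; omega) (by
        have := card_le_card (sdiff_subset : H \ Z ⊆ H)
        omega) hx' (hcon Z hZ x hx' y (mem_sdiff.2 ⟨hy, hyZ⟩))
    refine ⟨p.support.toFinset, ?_, ?_, by simp, by simp,
      reachable_support (fun a b (h : (mono G (H \ Z) fun _ => 0).Adj a b) => h.1) p _ (by simp)⟩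
    · intro v hv
      rw [List.mem_toFinset] at hv
      by_cases hvx : v = x
      · rwa [hvx]
      · obtain ⟨z, hz⟩ := exists_adj_of_reachable_ne
          (p.takeUntil v hv).reachable.symm hvx
        exact hz.2.1
    · refine (List.toFinset_card_le _).trans ?_
      rw [SimpleGraph.Walk.length_support]; omega
  · push Not at hcon
    obtain ⟨Z, hZ, x, hx, y, hy, hxy⟩ := hcon
    set F := mono G (H \ Z) fun _ => 0 with hF
    let Q₁ := (H \ Z).filter fun v => F.Reachable x v
    let Q₂ := (H \ Z).filter fun v => ¬ F.Reachable x v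
    have hcard : Q₁.card + Q₂.card = (H \ Z).card := card_filter_add_card_filter_not _
    have hle := card_le_card (sdiff_subset : H \ Z ⊆ H)
    have hcl₁ : ∀ v ∈ Q₁, ∀ w ∈ H \ Z, G.Adj v w → w ∈ Q₁ := by
      intro v hv w hw hvw
      obtain ⟨h1, h2⟩ := mem_filter.1 hv
      exact mem_filter.2 ⟨hw, h2.trans (SimpleGraph.Adj.reachable ⟨hvw, h1, hw, rfl⟩)⟩
    have hcl₂ : ∀ v ∈ Q₂, ∀ w ∈ H \ Z, G.Adj v w → w ∈ Q₂ := by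
      intro v hv w hw hvw
      obtain ⟨h1, h2⟩ := mem_filter.1 hv
      exact mem_filter.2 ⟨hw, fun h => h2 (h.trans
        (SimpleGraph.Adj.reachable ⟨hvw.symm, hw, h1, rfl⟩))⟩
    have hmain : ∀ Q ⊆ H \ Z, Q.Nonempty → Q.card ≤ n →
        (∀ v ∈ Q, ∀ w ∈ H \ Z, G.Adj v w → w ∈ Q) →
        ∃ U ⊆ H, U.Nonempty ∧ Robust G K U ∧ ∀ x ∈ U, d ≤ (nbrIn G U x).card + K := by
      intro Q hQ hQ0 hQn hcl
      have hdeg : ∀ x ∈ Q, d ≤ (nbrIn G Q x).card + K := fun v hv => hdZ Z hZ Q hQ v hv (hcl v hv)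
      exact ⟨Q, hQ.trans sdiff_subset, hQ0, robust_of_common (d := d - K) hQn
        (fun v hv => by have := hdeg v hv; omega) (by omega), hdeg⟩
    by_cases hsmall : Q₁.card ≤ n
    · exact hmain Q₁ (filter_subset _ _)
        ⟨x, mem_filter.2 ⟨hx, SimpleGraph.Reachable.refl _⟩⟩ hsmall hcl₁
    · exact hmain Q₂ (filter_subset _ _) ⟨y, mem_filter.2 ⟨hy, hxy⟩⟩ (by omega) hcl₂

end

/-! ### Massed pairs are linked -/

noncomputable section

variable {V : Type u} [Fintype V]

/-- Choose `E` to minimise the separator from `U`. Menger's theorem and the robustness of `U` make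
`E` linked to this separator. Each vertex of `U` has more neighbours in `U` than the separator has
vertices, so the separator is just the boundary of `E` and `E` is nonempty: a rigid part. -/
theorem Massed.linked_of_robust {Λ m : ℕ} {G : SimpleGraph V} {R X U : Finset V}
    (ih : ∀ (G' : SimpleGraph V) (R' X' : Finset V), R'.card < R.card → X'.card ≤ m →
      Massed Λ G' R' X' → Linked G' R' X')
    (hM : Massed Λ G R X) (hX : X.card ≤ m) (hUR : U ⊆ R) (hU0 : U.Nonempty)
    (hU : Robust G (7 * m) U) (hdeg : ∀ x ∈ U, m < (nbrIn G U x).card) : Linked G R X := by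
  obtain ⟨E, hE, hmin⟩ := exists_min_image R.powerset (fun E => (sep G U E).card)
    ⟨R, mem_powerset_self R⟩
  rw [mem_powerset] at hE
  have hsepR : (sep G U R).card ≤ X.card := by
    apply card_le_card
    intro v hv
    obtain ⟨h1, h2⟩ := mem_sep.1 hv
    exact hM.bdry_sub (mem_bdry.2 ⟨h1, h2.resolve_left fun h => h1 (hUR h)⟩)
  have hsepE : (sep G U E).card ≤ X.card := (hmin R (mem_powerset_self R)).trans hsepR
  have hUsep : ∀ v ∈ U, v ∉ sep G U E → v ∈ E := by
    intro v hv h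
    by_contra hvE
    exact h (mem_sep.2 ⟨hvE, Or.inl hv⟩)
  have hL : Linked G E (sep G U E) := by
    refine linked_of_target (G' := G) (Q := U) (T := U) le_rfl
      (fun E' h => hmin E' (mem_powerset.2 (h.trans hE))) (fun S hS hSc c => ?_)
      (fun a h _ => h) (fun a h _ _ => h) subset_union_left (fun v hv => ?_)
    · exact hU.link hS (by omega) c
    · by_cases h : v ∈ sep G U E
      · exact mem_union_right _ h
      · exact mem_union_left _ (hUsep v hv h)
  have heq : sep G U E = bdry G E := by
    ext v
    rw [mem_sep, mem_bdry]
    refine ⟨fun ⟨h1, h2⟩ => ⟨h1, ?_⟩, fun ⟨h1, h2⟩ => ⟨h1, Or.inr h2⟩⟩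
    rcases h2 with h2 | h2
    · obtain ⟨w, hw, hw'⟩ := exists_mem_notMem_of_card_lt_card
        (show (sep G U E).card < (nbrIn G U v).card from (hsepE.trans hX).trans_lt (hdeg v h2))
      obtain ⟨hwU, hvw⟩ := mem_nbrIn.1 hw
      exact ⟨w, hUsep w hwU hw', hvw.symm⟩
    · exact h2
  obtain ⟨x, hx⟩ := hU0
  obtain ⟨w, hw, hw'⟩ := exists_mem_notMem_of_card_lt_card
    (show (sep G U E).card < (nbrIn G U x).card from (hsepE.trans hX).trans_lt (hdeg x hx))
  rw [heq] at hL hsepE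
  exact hM.linked_of_rigid ih hX hE ⟨w, hUsep w (mem_nbrIn.1 hw).1 hw'⟩ hsepE hL

theorem touch_empty (G : SimpleGraph V) : touch G ∅ = 0 := by simp [touch]

theorem touch_le_of_edgeless {G : SimpleGraph V} {R : Finset V}
    (h : ∀ a ∈ R, ∀ b ∈ R, ¬ G.Adj a b) : touch G R ≤ 2 * ((bdry G R).card * R.card) := by
  have : (univ.filter fun p : V × V => G.Adj p.1 p.2 ∧ (p.1 ∈ R ∨ p.2 ∈ R)) ⊆
      (bdry G R ×ˢ R) ∪ (R ×ˢ bdry G R) := by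
    rintro ⟨a, b⟩ hp
    simp only [mem_filter, mem_univ, true_and] at hp
    simp only [mem_union, mem_product]
    obtain ⟨hab, ha | hb⟩ := hp
    · exact Or.inr ⟨ha, mem_bdry.2 ⟨fun hb => h a ha b hb hab, a, ha, hab⟩⟩
    · exact Or.inl ⟨mem_bdry.2 ⟨fun ha => h a ha b hb hab, b, hb, hab.symm⟩, hb⟩
  refine (card_le_card this).trans ((card_union_le _ _).trans ?_)
  rw [card_product, card_product]
  linarith [mul_comm R.card (bdry G R).card]

/-- Contracting an edge that lies in few triangles loses few edges. -/
theorem touch_contract {G : SimpleGraph V} {R : Finset V} {u v : V} (hu : u ∈ R) (huv : G.Adj u v) :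
    touch G R ≤ touch (contract G u v) (R.erase v) +
      2 * ((nbrIn G univ u ∩ nbrIn G univ v).card + 1) := by
  set C := nbrIn G univ u ∩ nbrIn G univ v with hC
  have hmemC : ∀ z, z ∈ C ↔ G.Adj u z ∧ G.Adj v z := by
    intro z; simp [hC, mem_nbrIn]
  set π : V → V := fun a => if a = v then u else a with hπ
  set B : Finset (V × V) := ({v} ×ˢ insert u C) ∪ (insert u C ×ˢ {v}) with hB
  have hBc : B.card ≤ 2 * (C.card + 1) := by
    refine (card_union_le _ _).trans ?_
    rw [card_product, card_product, card_singleton]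
    have := card_insert_le u C
    omega
  set A := univ.filter fun p : V × V => G.Adj p.1 p.2 ∧ (p.1 ∈ R ∨ p.2 ∈ R) with hA
  have hπu : ∀ a, a ≠ v → π a = a := fun a ha => if_neg ha
  have hπv : π v = u := if_pos rfl
  have hmemB : ∀ a b, (a, b) ∈ A \ B → G.Adj a b ∧ (a ∈ R ∨ b ∈ R) ∧
      (a = v → b ≠ u ∧ ¬ G.Adj u b) ∧ (b = v → a ≠ u ∧ ¬ G.Adj u a) := by
    intro a b h
    obtain ⟨h1, h2⟩ := mem_sdiff.1 h
    simp only [hA, mem_filter, mem_univ, true_and] at h1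
    simp only [hB, mem_union, mem_product, mem_singleton, mem_insert, hmemC, not_or, not_and] at h2
    refine ⟨h1.1, h1.2, ?_, ?_⟩
    · rintro rfl
      exact ⟨fun h => h2.1 rfl |>.1 h, fun h => (h2.1 rfl).2 h h1.1⟩
    · rintro rfl
      constructor
      · intro h; exact h2.2 (Or.inl h) rfl
      · intro h; exact h2.2 (Or.inr ⟨h, h1.1.symm⟩) rfl
  have hinj : (A \ B).card ≤ touch (contract G u v) (R.erase v) := by
    refine card_le_card_of_injOn (fun p => (π p.1, π p.2)) ?_ ?_
    · rintro ⟨a, b⟩ hab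
      obtain ⟨h1, h2, h3, h4⟩ := hmemB a b hab
      simp only [coe_filter, mem_univ, true_and, Set.mem_ofPred_eq, mem_erase]
      by_cases ha : a = v
      · subst ha
        have hb : b ≠ a := h1.ne'
        rw [hπv, hπu b hb]
        exact ⟨⟨(h3 rfl).1.symm, huv.ne, hb, Or.inr (Or.inl ⟨rfl, h1⟩)⟩, Or.inl ⟨huv.ne, hu⟩⟩
      · by_cases hb : b = v
        · subst hb
          rw [hπv, hπu a ha]
          exact ⟨⟨(h4 rfl).1, ha, huv.ne, Or.inr (Or.inr ⟨rfl, h1.symm⟩)⟩, Or.inr ⟨huv.ne, hu⟩⟩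
        · rw [hπu a ha, hπu b hb]
          exact ⟨⟨h1.ne, ha, hb, Or.inl h1⟩, h2.imp (⟨ha, ·⟩) (⟨hb, ·⟩)⟩
    · rintro ⟨a, b⟩ hab ⟨a', b'⟩ hab' heq
      obtain ⟨h1, h2, h3, h4⟩ := hmemB a b hab
      obtain ⟨h1', h2', h3', h4'⟩ := hmemB a' b' hab'
      simp only [Prod.mk.injEq, hπ] at heq ⊢
      have hvu := huv.ne'
      split_ifs at heq <;> grind [SimpleGraph.Adj.symm, SimpleGraph.irrefl]
  have h1 : A.card ≤ (A \ B).card + B.card := by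
    have := card_le_card_sdiff_add_card (s := A) (t := B)
    omega
  have h2 : touch G R = A.card := rfl
  omega

/-- A massed pair is linked. -/
theorem Massed.linked {lam m : ℕ} (hlam : 24 * m + 2 ≤ lam) {G : SimpleGraph V} {R X : Finset V}
    (hX : X.card ≤ m) (hM : Massed (2 * lam) G R X) : Linked G R X := by
  induction hr : R.card using Nat.strong_induction_on generalizing G R X with
  | _ r ihr =>
  subst hr
  replace ihr : ∀ (G' : SimpleGraph V) (R' X' : Finset V), R'.card < R.card → X'.card ≤ m →
      Massed (2 * lam) G' R' X' → Linked G' R' X' := fun G' R' X' h1 h2 h3 => ihr _ h1 h2 h3 rfl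
  induction ht : touch G R using Nat.strong_induction_on generalizing G with
  | _ t iht =>
  subst ht
  by_contra hnot
  have hrigid : ∀ D ⊆ R, D.Nonempty → (bdry G D).card ≤ X.card → ¬ Linked G D (bdry G D) :=
    fun D h1 h2 h3 h4 => hnot (hM.linked_of_rigid ihr hX h1 h2 h3 h4)
  -- A violating part would be massed, hence linked by induction, hence rigid. So for proper parts
  -- the bound extends to boundary size exactly `X.card`. Edge deletions and contractions, which
  -- change boundaries by at most one, consume this slack.
  have htouch : ∀ D ⊆ R, D ≠ R → (bdry G D).card ≤ X.card → touch G D ≤ 2 * lam * D.card := by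
    intro D hDR hne hDX
    by_contra hlt
    rw [not_le] at hlt
    have hD0 : D.Nonempty := by
      rw [nonempty_iff_ne_empty]
      rintro rfl
      simp [touch_empty] at hlt
    refine hrigid D hDR hD0 hDX (ihr G D _ (card_lt_card (hDR.ssubset_of_ne hne)) (hDX.trans hX)
      (Massed.of_minimal hlt fun D' hD' hD'lt => ?_))
    exact hM.touch_le D' (hD'.trans hDR) (hD'lt.trans_le hDX)
  have hlt := hM.lt_touch
  -- few edges
  have hfew : touch G R ≤ 2 * lam * R.card + 2 := by
    by_contra hmany
    obtain ⟨a, ha, b, hb, hab⟩ : ∃ a ∈ R, ∃ b ∈ R, G.Adj a b := by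
      by_contra h
      push Not at h
      have h1 := touch_le_of_edgeless h
      rw [hM.bdry_eq] at h1
      have h2 : X.card * R.card ≤ lam * R.card := Nat.mul_le_mul_right _ (by omega)
      have h3 : 2 * lam * R.card = 2 * (lam * R.card) := by ring
      omega
    obtain ⟨G', hadj⟩ : ∃ G' : SimpleGraph V, ∀ x y, G'.Adj x y ↔ G.Adj x y ∧ s(x, y) ≠ s(a, b) :=
      ⟨G.deleteEdges {s(a, b)}, by simp⟩
    have hle : G' ≤ G := fun x y h => ((hadj x y).1 h).1
    have hbR : bdry G' R = X := by
      rw [← hM.bdry_eq]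
      ext v
      simp only [mem_bdry, hadj]
      refine ⟨fun ⟨h1, d, h2, h3, _⟩ => ⟨h1, d, h2, h3⟩,
        fun ⟨h1, d, h2, h3⟩ => ⟨h1, d, h2, h3, fun h => h1 ?_⟩⟩
      rcases Sym2.eq_iff.1 h with ⟨-, rfl⟩ | ⟨-, rfl⟩ <;> assumption
    have htl : touch G R ≤ touch G' R + 2 := by
      have hsub : (univ.filter fun p : V × V => G.Adj p.1 p.2 ∧ (p.1 ∈ R ∨ p.2 ∈ R)) ⊆
          (univ.filter fun p : V × V => G'.Adj p.1 p.2 ∧ (p.1 ∈ R ∨ p.2 ∈ R)) ∪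
            {(a, b), (b, a)} := by
        rintro ⟨x, y⟩ hp
        simp only [mem_union, mem_filter, mem_univ, true_and, hadj, mem_insert, mem_singleton,
          Prod.mk.injEq] at hp ⊢
        by_cases h : s(x, y) = s(a, b)
        · exact Or.inr (Sym2.eq_iff.1 h)
        · exact Or.inl ⟨⟨hp.1, h⟩, hp.2⟩
      exact (card_le_card hsub).trans ((card_union_le _ _).trans
        (Nat.add_le_add_left card_le_two _))
    have htl' : touch G' R < touch G R := by
      apply card_lt_card
      refine ⟨fun p hp => ?_, fun hsub => ?_⟩
      · simp only [mem_filter, mem_univ, true_and] at hp ⊢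
        exact ⟨hle hp.1, hp.2⟩
      · have := @hsub (a, b) (mem_filter.2 ⟨mem_univ _, hab, Or.inl ha⟩)
        simp only [mem_filter, mem_univ, true_and, hadj] at this
        exact this.1.2 rfl
    refine hnot (Linked.mono_left hle (iht _ htl' ⟨hM.disj, hbR.le, by omega, ?_⟩ rfl))
    intro D hDR hDX
    by_cases hD : D = R
    · rw [hD, hbR] at hDX; exact absurd hDX (lt_irrefl _)
    have hsub : bdry G D ⊆ insert (if a ∈ D then b else a) (bdry G' D) := by
      intro v hv
      rw [mem_insert]
      obtain ⟨h2, d, h3, h4⟩ := mem_bdry.1 hv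
      by_cases hd : s(d, v) = s(a, b)
      · left
        rcases Sym2.eq_iff.1 hd with ⟨rfl, rfl⟩ | ⟨rfl, rfl⟩
        · rw [if_pos h3]
        · rw [if_neg h2]
      · exact Or.inr (mem_bdry.2 ⟨h2, d, h3, (hadj d v).2 ⟨h4, hd⟩⟩)
    have h1 := (card_le_card hsub).trans (card_insert_le _ _)
    refine le_trans ?_ (htouch D hDR hD (by omega))
    apply card_le_card
    intro p hp
    simp only [mem_filter, mem_univ, true_and] at hp ⊢
    exact ⟨hle hp.1, hp.2⟩
  -- many triangles at each edge
  have htri : ∀ u ∈ R, ∀ v ∈ R, G.Adj u v → lam ≤ (nbrIn G univ u ∩ nbrIn G univ v).card := by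
    intro u hu v hv huv
    by_contra hC
    have h1 := touch_contract hu huv
    have hcard := card_erase_add_one hv
    have hRv : (R.erase v).card < R.card := by omega
    have hdu : ∀ D ⊆ R.erase v, ∀ x, x ≠ v → x ∉ D → (∃ d ∈ D, G.Adj d x) →
        x ∈ bdry (contract G u v) D := by
      rintro D hD x hxv hxD ⟨d, hd, hdx⟩
      exact mem_bdry.2 ⟨hxD, d, hd, hdx.ne, (mem_erase.1 (hD hd)).1, hxv, Or.inl hdx⟩
    have hMc : Massed (2 * lam) (contract G u v) (R.erase v) X := by
      refine ⟨disjoint_of_subset_left (erase_subset _ _) hM.disj, ?_, ?_, ?_⟩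
      · intro x hx
        obtain ⟨h2, d, hd, hne, hdv, hxv, h⟩ := mem_bdry.1 hx
        have hxR : x ∉ R := fun h => h2 (mem_erase.2 ⟨hxv, h⟩)
        rcases h with h | ⟨-, h⟩ | ⟨rfl, -⟩
        · exact hM.bdry_sub (mem_bdry.2 ⟨hxR, d, (mem_erase.1 hd).2, h⟩)
        · exact hM.bdry_sub (mem_bdry.2 ⟨hxR, v, hv, h⟩)
        · exact absurd hu hxR
      · rw [← hcard, mul_add] at hlt
        omega
      · by_contra hcon
        obtain ⟨D, hDR, hDX, hDt, hDM⟩ := exists_massed hcon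
        have hDR' : D ⊆ R := hDR.trans (erase_subset _ _)
        have hvD : v ∉ D := fun h => (mem_erase.1 (hDR h)).1 rfl
        -- If `u ∈ D`, undoing the contraction adds `v` to `D` without changing the boundary and
        -- yields a rigid part. If `u ∉ D`, the boundary in `G` gains at most `v`, and `htouch`
        -- applies.
        by_cases huD : u ∈ D
        · have hL := ihr _ _ _ ((card_le_card hDR).trans_lt hRv) (hDX.le.trans hX) hDM
          have hvY : v ∉ bdry (contract G u v) D := by
            intro h
            obtain ⟨-, d, -, h⟩ := mem_bdry.1 h
            exact h.2.2.1 rfl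
          have hL' := hL.of_contract huv huD hvY
          have heq : bdry G (insert v D) = bdry (contract G u v) D := by
            ext x
            constructor
            · intro hx
              obtain ⟨h2, d, hd, hdx⟩ := mem_bdry.1 hx
              rw [mem_insert, not_or] at h2
              rcases mem_insert.1 hd with rfl | hd
              · exact mem_bdry.2 ⟨h2.2, u, huD, fun h => h2.2 (h ▸ huD), huv.ne, h2.1,
                  Or.inr (Or.inl ⟨rfl, hdx⟩)⟩
              · exact hdu D hDR x h2.1 h2.2 ⟨d, hd, hdx⟩
            · intro hx
              obtain ⟨h2, d, hd, hne, hdv, hxv, h⟩ := mem_bdry.1 hx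
              have h2' : x ∉ insert v D := by simp [h2, hxv]
              rcases h with h | ⟨-, h⟩ | ⟨rfl, -⟩
              · exact mem_bdry.2 ⟨h2', d, mem_insert_of_mem hd, h⟩
              · exact mem_bdry.2 ⟨h2', v, mem_insert_self _ _, h⟩
              · exact absurd huD h2
          rw [← heq] at hL' hDX
          exact hrigid _ (insert_subset hv hDR') (insert_nonempty _ _) hDX.le hL'
        · have hsub : bdry G D ⊆ insert v (bdry (contract G u v) D) := by
            intro x hx
            by_cases hxv : x = v
            · exact mem_insert.2 (Or.inl hxv)
            · obtain ⟨h2, h3⟩ := mem_bdry.1 hx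
              exact mem_insert_of_mem (hdu D hDR x hxv h2 h3)
          have h2 := (card_le_card hsub).trans (card_insert_le _ _)
          have h3 := htouch D hDR' (fun h => hvD (h ▸ hv)) (by omega)
          have h4 : touch (contract G u v) D ≤ touch G D := by
            -- An edge at `u` that exists only because of the contraction is sent back to the edge
            -- at `v` it came from.
            refine card_le_card_of_injOn (fun p => (if p.1 = u ∧ ¬ G.Adj p.1 p.2 then v else p.1,
              if p.2 = u ∧ ¬ G.Adj p.1 p.2 then v else p.2)) ?_ ?_
            · rintro ⟨x, y⟩ hp
              simp only [coe_filter, mem_univ, true_and, Set.mem_ofPred_eq] at hp ⊢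
              obtain ⟨⟨hne, hxv, hyv, h⟩, hxy⟩ := hp
              rcases h with h | ⟨rfl, h⟩ | ⟨rfl, h⟩
              · simp [h, hxy]
              · by_cases hxy' : G.Adj x y
                · simp [hxy', hxy]
                · simp [hxy', hne.symm, h, hxy.resolve_left huD]
              · by_cases hxy' : G.Adj x y
                · simp [hxy', hxy]
                · simp [hxy', hne, h.symm, hxy.resolve_right huD]
            · rintro ⟨x, y⟩ hp ⟨x', y'⟩ hp' heq
              simp only [coe_filter, mem_univ, true_and, Set.mem_ofPred_eq] at hp hp'
              obtain ⟨⟨hne, hxv, hyv, h⟩, hxy⟩ := hp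
              obtain ⟨⟨hne', hxv', hyv', h'⟩, hxy'⟩ := hp'
              simp only [Prod.mk.injEq] at heq ⊢
              clear hM ihr iht hrigid htouch hnot hfew
              split_ifs at heq <;> grind
          omega
    have := (ihr _ _ _ hRv hX hMc).of_contract huv (mem_erase.2 ⟨huv.ne, hu⟩)
      (fun h => Finset.disjoint_left.1 hM.disj hv h)
    rw [insert_erase hv] at this
    exact hnot this
  -- a vertex of small degree
  obtain ⟨v, hv, hdeg⟩ : ∃ v ∈ R, (nbrIn G univ v).card ≤ 2 * lam + 2 := by
    by_contra h
    push Not at h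
    have h1 : ∑ v ∈ R, (nbrIn G univ v).card ≤ touch G R := by
      rw [← card_sigma]
      refine card_le_card_of_injOn (fun p => (p.1, p.2)) ?_ ?_
      · rintro ⟨a, b⟩ hp
        simp only [coe_sigma, Set.mem_sigma_iff, mem_coe, mem_nbrIn, mem_univ, true_and] at hp
        simp only [coe_filter, mem_univ, true_and, Set.mem_ofPred_eq]
        exact ⟨hp.2, Or.inl hp.1⟩
      · rintro ⟨a, b⟩ - ⟨a', b'⟩ - heq
        simp only [Prod.mk.injEq] at heq
        obtain ⟨rfl, rfl⟩ := heq
        rfl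
    have h2 : R.card * (2 * lam + 3) ≤ ∑ v ∈ R, (nbrIn G univ v).card := by
      rw [← smul_eq_mul]
      exact card_nsmul_le_sum _ _ _ fun v hv => h v hv
    have h3 : 0 < R.card := by
      rw [card_pos, nonempty_iff_ne_empty]
      rintro rfl
      simp [touch_empty] at hlt
    have h4 : R.card * (2 * lam + 3) = 2 * lam * R.card + 3 * R.card := by ring
    omega
  -- Without neighbours in `R`, the vertex `v` accounts for at most `2 * X.card` ordered pairs, so
  -- `R.erase v` would be a proper part violating `htouch`.
  have hH0 : (nbrIn G R v).Nonempty := by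
    by_contra h0
    rw [not_nonempty_iff_eq_empty] at h0
    have hvR : ∀ x ∈ R, ¬ G.Adj v x := by
      intro x hx hvx
      have : x ∈ nbrIn G R v := mem_nbrIn.2 ⟨hx, hvx⟩
      simp [h0] at this
    have hcard := card_erase_add_one hv
    have h1 : bdry G (R.erase v) ⊆ X := by
      intro x hx
      obtain ⟨h2, d, hd, hdx⟩ := mem_bdry.1 hx
      refine hM.bdry_sub (mem_bdry.2 ⟨fun hxR => ?_, d, (mem_erase.1 hd).2, hdx⟩)
      have hxv : x = v := by
        by_contra h; exact h2 (mem_erase.2 ⟨h, hxR⟩)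
      exact hvR d (mem_erase.1 hd).2 (hxv ▸ hdx.symm)
    have h2 := htouch (R.erase v) (erase_subset _ _)
      (fun h => by rw [h] at hcard; omega) (card_le_card h1)
    have h3 : touch G R ≤ touch G (R.erase v) + 2 * X.card := by
      have hsub : (univ.filter fun p : V × V => G.Adj p.1 p.2 ∧ (p.1 ∈ R ∨ p.2 ∈ R)) ⊆
          (univ.filter fun p : V × V => G.Adj p.1 p.2 ∧ (p.1 ∈ R.erase v ∨ p.2 ∈ R.erase v)) ∪
            (({v} ×ˢ X) ∪ (X ×ˢ {v})) := by
        rintro ⟨x, y⟩ hp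
        simp only [mem_union, mem_filter, mem_univ, true_and, mem_product, mem_singleton,
          mem_erase] at hp ⊢
        by_cases hx : x = v
        · subst hx
          have hy : y ∉ R := fun hy => hvR y hy hp.1
          exact Or.inr (Or.inl ⟨rfl, hM.bdry_sub (mem_bdry.2 ⟨hy, x, hv, hp.1⟩)⟩)
        · by_cases hy : y = v
          · subst hy
            have hx : x ∉ R := fun hx => hvR x hx hp.1.symm
            exact Or.inr (Or.inr ⟨hM.bdry_sub (mem_bdry.2 ⟨hx, y, hv, hp.1.symm⟩), rfl⟩)
          · exact Or.inl ⟨hp.1, by tauto⟩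
      refine (card_le_card hsub).trans ((card_union_le _ _).trans (Nat.add_le_add_left ?_ _))
      refine (card_union_le _ _).trans ?_
      rw [card_product, card_product, card_singleton]; omega
    rw [← hcard, mul_add] at hlt
    omega
  have hHc : (nbrIn G R v).card ≤ 2 * (lam + 1) :=
    (card_le_card (filter_subset_filter _ (subset_univ _))).trans (by
      have := hdeg; simp only [nbrIn] at this ⊢; omega)
  have hHd : ∀ x ∈ nbrIn G R v, lam - m ≤ (nbrIn G (nbrIn G R v) x).card := by
    intro x hx
    obtain ⟨hxR, hvx⟩ := mem_nbrIn.1 hx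
    have h1 := htri v hv x hxR hvx
    have hsub : nbrIn G univ v ∩ nbrIn G univ x ⊆ nbrIn G (nbrIn G R v) x ∪ X := by
      intro z hz
      simp only [mem_inter, mem_nbrIn, mem_univ, true_and] at hz
      by_cases hzR : z ∈ R
      · exact mem_union_left _ (mem_nbrIn.2 ⟨mem_nbrIn.2 ⟨hzR, hz.1⟩, hz.2⟩)
      · exact mem_union_right _ (hM.bdry_sub (mem_bdry.2 ⟨hzR, v, hv, hz.1⟩))
    have h2 := (card_le_card hsub).trans (card_union_le _ _)
    omega
  -- With `n = lam + 1`, `d = lam - m` and `K = 7 * m` the two conditions read `24 * m < lam + 1`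
  -- and `23 * m + 1 < lam`, hence the assumption `24 * m + 2 ≤ lam`.
  obtain ⟨U, hUH, hU0, hU, hUd⟩ := exists_robust (K := 7 * m) hH0 hHc hHd (by omega) (by omega)
  exact hnot (hM.linked_of_robust ihr hX (hUH.trans (filter_subset _ _)) hU0 hU
    fun x hx => by have := hUd x hx; omega)

end

/-! ### Dense graphs contain subdivisions of K_{s,t} -/

noncomputable section

variable {V : Type u}

/-- A subdivision of `K_{s,t}` in `G`, given by its branch vertices and connected sets that contain
the subdivided edges. -/
structure KstModel (s t : ℕ) (G : SimpleGraph V) where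
  f : Fin s → V
  g : Fin t → V
  C : Fin s → Fin t → Finset V
  f_inj : Function.Injective f
  g_inj : Function.Injective g
  f_ne_g : ∀ i j, f i ≠ g j
  reach : ∀ i j, (mono G (C i j) fun _ => 0).Reachable (f i) (g j)
  f_mem : ∀ i j i', f i' ∈ C i j → i' = i
  g_mem : ∀ i j j', g j' ∈ C i j → j' = j
  inter : ∀ i j i' j', (i, j) ≠ (i', j') → ∀ x ∈ C i j, x ∈ C i' j' →
    (∃ k, f k = x) ∨ ∃ k, g k = x

theorem KstModel.exists_path {s t : ℕ} {G : SimpleGraph V} (M : KstModel s t G) (i : Fin s)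
    (j : Fin t) : ∃ p : G.Walk (M.f i) (M.g j), p.IsPath ∧ ∀ x ∈ p.support, x ∈ M.C i j := by
  obtain ⟨p, hp⟩ := (M.reach i j).exists_isPath
  have hle : (mono G (M.C i j) fun _ => 0) ≤ G := fun a b h => h.1
  refine ⟨p.mapLe hle, hp.mapLe hle, fun x hx => ?_⟩
  rw [SimpleGraph.Walk.support_mapLe_eq_support] at hx
  by_cases hxf : x = M.f i
  · obtain ⟨z, hz⟩ := exists_adj_of_reachable_ne (M.reach i j) (M.f_ne_g i j)
    exact hxf ▸ hz.2.1
  · obtain ⟨z, hz⟩ := exists_adj_of_reachable_ne (p.takeUntil x hx).reachable.symm hxf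
    exact hz.2.1

/-- Any paths chosen inside the sets `C i j` will do: distinct sets meet only in branch vertices, so
the paths do too. -/
theorem KstModel.isTopologicalMinor {s t : ℕ} {G : SimpleGraph V} (M : KstModel s t G) :
    IsTopologicalMinor (completeBipartiteGraph (Fin s) (Fin t)) G := by
  choose p hp hpC using M.exists_path
  let f : Fin s ⊕ Fin t → V := Sum.elim M.f M.g
  let P : ∀ a b : Fin s ⊕ Fin t, (completeBipartiteGraph (Fin s) (Fin t)).Adj a b →
      G.Walk (f a) (f b)
    | .inl i, .inr j, _ => p i j
    | .inr j, .inl i, _ => (p i j).reverse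
    | .inl _, .inl _, h => by simp at h
    | .inr _, .inr _, h => by simp at h
  have hsymm : ∀ a b h, P b a h = (P a b h.symm).reverse := by
    rintro (i | j) (i' | j') h
    · simp at h
    · rfl
    · exact (SimpleGraph.Walk.reverse_reverse _).symm
    · simp at h
  have hP : ∀ a b h, ∃ i j, s(a, b) = s(.inl i, .inr j) ∧
      (∀ x, x ∈ (P a b h).support → x ∈ M.C i j) ∧ (P a b h).IsPath := by
    rintro (i | j) (i' | j') h
    · simp at h
    · exact ⟨i, j', rfl, hpC i j', hp i j'⟩
    · refine ⟨i', j, Sym2.eq_swap, fun x hx => hpC i' j x ?_, (hp i' j).reverse⟩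
      exact (List.mem_reverse.1 ((SimpleGraph.Walk.support_reverse (p i' j)) ▸ hx))
    · simp at h
  let S : G.Subgraph :=
    { verts := {x | x ∈ Set.range f ∨ ∃ a b, ∃ h, x ∈ (P a b h).support}
      Adj := fun x y => ∃ a b, ∃ h, s(x, y) ∈ (P a b h).edges
      adj_sub := fun ⟨a, b, h, hxy⟩ => (P a b h).adj_of_mem_edges hxy
      edge_vert := fun ⟨a, b, h, hxy⟩ =>
        Or.inr ⟨a, b, h, SimpleGraph.Walk.fst_mem_support_of_mem_edges _ hxy⟩
      symm := ⟨fun x y ⟨a, b, h, hxy⟩ => ⟨a, b, h, Sym2.eq_swap ▸ hxy⟩⟩ }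
  refine ⟨S, f, P, ?_, ?_, ?_, ?_, ?_, fun x => Iff.rfl, fun x y => Iff.rfl⟩
  · exact M.f_inj.sumElim M.g_inj M.f_ne_g
  · intro a b h
    obtain ⟨-, -, -, -, h'⟩ := hP a b h
    exact h'
  · exact fun a b h => hsymm a b h.symm
  · rintro a b h w hw
    obtain ⟨i, j, hab, hC, -⟩ := hP a b h
    have : w ∈ s(a, b) := by
      rw [hab, Sym2.mem_iff]
      rcases w with k | k
      · exact Or.inl (congrArg _ (M.f_mem i j k (hC _ hw)))
      · exact Or.inr (congrArg _ (M.g_mem i j k (hC _ hw)))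
    exact Sym2.mem_iff.1 this
  · intro a b h a' b' h' hne x hx hx'
    obtain ⟨i, j, hab, hC, -⟩ := hP a b h
    obtain ⟨i', j', hab', hC', -⟩ := hP a' b' h'
    have : (i, j) ≠ (i', j') := by
      rintro heq
      obtain ⟨rfl, rfl⟩ := Prod.mk.inj heq
      exact hne (hab.trans hab'.symm)
    rcases M.inter i j i' j' this x (hC x hx) (hC' x hx') with ⟨k, rfl⟩ | ⟨k, rfl⟩
    · exact ⟨.inl k, rfl⟩
    · exact ⟨.inr k, rfl⟩

variable [Fintype V]

theorem pairs_le_sq (G : SimpleGraph V) (W : Finset V) : pairs G W ≤ W.card * W.card := by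
  rw [← card_product]
  apply card_le_card
  intro p hp
  simp only [mem_filter, mem_univ, true_and] at hp
  exact mem_product.2 hp.2

theorem pairs_le_erase (G : SimpleGraph V) (W : Finset V) (v : V) :
    pairs G W ≤ pairs G (W.erase v) + 2 * (nbrIn G W v).card := by
  have hsub : (univ.filter fun p : V × V => G.Adj p.1 p.2 ∧ p.1 ∈ W ∧ p.2 ∈ W) ⊆
      (univ.filter fun p : V × V => G.Adj p.1 p.2 ∧ p.1 ∈ W.erase v ∧ p.2 ∈ W.erase v) ∪
        (({v} ×ˢ nbrIn G W v) ∪ (nbrIn G W v ×ˢ {v})) := by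
    rintro ⟨x, y⟩ hp
    simp only [mem_union, mem_filter, mem_univ, true_and, mem_product, mem_singleton,
      mem_erase, mem_nbrIn] at hp ⊢
    by_cases hx : x = v
    · subst hx; exact Or.inr (Or.inl ⟨rfl, hp.2.2, hp.1⟩)
    · by_cases hy : y = v
      · subst hy; exact Or.inr (Or.inr ⟨⟨hp.2.1, hp.1.symm⟩, rfl⟩)
      · exact Or.inl ⟨hp.1, ⟨hx, hp.2.1⟩, hy, hp.2.2⟩
  refine (card_le_card hsub).trans ((card_union_le _ _).trans (Nat.add_le_add_left ?_ _))
  refine (card_union_le _ _).trans ?_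
  rw [card_product, card_product, card_singleton]; omega

/-- A dense graph has a dense subgraph of large minimum degree that is minimal in Mader's sense. -/
theorem exists_mader {G : SimpleGraph V} {q Γ : ℕ} (hq : 1 ≤ q) (hΓ : 4 * q ≤ Γ) {W₀ : Finset V}
    (hW₀ : W₀.Nonempty) (hd : Γ * W₀.card ≤ pairs G W₀) :
    ∃ W : Finset V, W.Nonempty ∧ Γ * W.card < pairs G W + Γ * q ∧
      (∀ v ∈ W, Γ < 2 * (nbrIn G W v).card) ∧
      ∀ W' ⊂ W, 2 * q ≤ W'.card → pairs G W' + Γ * q ≤ Γ * W'.card := by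
  have h0 : 2 * q ≤ W₀.card ∧ Γ * W₀.card < pairs G W₀ + Γ * q := by
    constructor
    · have h1 := hd.trans (pairs_le_sq G W₀)
      have := Nat.le_of_mul_le_mul_right h1 (card_pos.2 hW₀)
      omega
    · have : 0 < Γ * q := Nat.mul_pos (by omega) hq
      omega
  obtain ⟨W, hW, hmin⟩ := exists_min_image
    (univ.filter fun W : Finset V => 2 * q ≤ W.card ∧ Γ * W.card < pairs G W + Γ * q) card
    ⟨W₀, mem_filter.2 ⟨mem_univ _, h0⟩⟩
  obtain ⟨-, hW1, hW2⟩ := mem_filter.1 hW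
  have hmin' : ∀ W' ⊂ W, 2 * q ≤ W'.card → pairs G W' + Γ * q ≤ Γ * W'.card := by
    intro W' hW' hc
    by_contra h
    have := hmin W' (mem_filter.2 ⟨mem_univ _, hc, not_le.1 h⟩)
    have := card_lt_card hW'
    omega
  refine ⟨W, card_pos.1 (by omega), hW2, fun v hv => ?_, hmin'⟩
  -- On exactly `2 * q` vertices there are at most `4 * q * q ≤ Γ * q` pairs, which is too few.
  -- Hence minimality still applies after one vertex is deleted.
  have hlt : 2 * q < W.card := by
    refine lt_of_le_of_ne hW1 fun h => ?_
    have h1 := pairs_le_sq G W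
    rw [← h] at h1 hW2
    nlinarith
  have h1 := card_erase_add_one hv
  have h2 := hmin' (W.erase v) (erase_ssubset hv) (by omega)
  have h3 := pairs_le_erase G W v
  rw [← h1, mul_add] at hW2
  omega

/-- Deleting `Br` and ignoring pairs within `X` costs little compared with the density of `W`. A
nonempty `D` with small boundary would cover the edges of `W` by two proper subsets, `D` with its
boundary and `Br`, and `W \ D`. These overlap in at most `q` vertices, and the minimum degree makes
both large, so adding their sparsity bounds contradicts the density of `W`. -/
theorem massed_of_mader {G : SimpleGraph V} {q lam n m : ℕ} {W Br X : Finset V}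
    (hq : m + n ≤ q) (hW0 : W.Nonempty)
    (h1 : (2 * lam + 10 * q) * W.card < pairs G W + (2 * lam + 10 * q) * q)
    (h2 : ∀ v ∈ W, 2 * lam + 10 * q < 2 * (nbrIn G W v).card)
    (h3 : ∀ W' ⊂ W, 2 * q ≤ W'.card →
      pairs G W' + (2 * lam + 10 * q) * q ≤ (2 * lam + 10 * q) * W'.card)
    (hBr : Br.card ≤ n) (hBrW : Br ⊆ W) (hX : X.card ≤ m) (hXW : X ⊆ W \ Br) :
    Massed (2 * lam) (mono G (W \ Br) fun _ => 0) ((W \ Br) \ X) X := by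
  set J := mono G (W \ Br) fun _ => 0 with hJ
  have hJadj : ∀ a b, a ∈ W \ Br → b ∈ W \ Br → G.Adj a b → J.Adj a b :=
    fun a b ha hb hab => ⟨hab, ha, hb, rfl⟩
  refine ⟨sdiff_disjoint, ?_, ?_, ?_⟩
  · intro v hv
    obtain ⟨h4, d, -, hdv⟩ := mem_bdry.1 hv
    by_contra hvX
    exact h4 (mem_sdiff.2 ⟨hdv.2.2.1, hvX⟩)
  · have hp : pairs G W ≤ touch J ((W \ Br) \ X) + (2 * (n * W.card) + m * W.card) := by
      have hsub : (univ.filter fun p : V × V => G.Adj p.1 p.2 ∧ p.1 ∈ W ∧ p.2 ∈ W) ⊆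
          (univ.filter fun p : V × V => J.Adj p.1 p.2 ∧
            (p.1 ∈ (W \ Br) \ X ∨ p.2 ∈ (W \ Br) \ X)) ∪
            (((Br ×ˢ W) ∪ (W ×ˢ Br)) ∪ (X ×ˢ X)) := by
        rintro ⟨x, y⟩ hp
        simp only [mem_union, mem_filter, mem_univ, true_and, mem_product] at hp ⊢
        by_cases hx : x ∈ Br
        · exact Or.inr (Or.inl (Or.inl ⟨hx, hp.2.2⟩))
        by_cases hy : y ∈ Br
        · exact Or.inr (Or.inl (Or.inr ⟨hp.2.1, hy⟩))
        have hx' := mem_sdiff.2 ⟨hp.2.1, hx⟩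
        have hy' := mem_sdiff.2 ⟨hp.2.2, hy⟩
        by_cases hxy : x ∈ X ∧ y ∈ X
        · exact Or.inr (Or.inr hxy)
        · refine Or.inl ⟨hJadj x y hx' hy' hp.1, ?_⟩
          by_cases hxX : x ∈ X
          · exact Or.inr (mem_sdiff.2 ⟨hy', fun h => hxy ⟨hxX, h⟩⟩)
          · exact Or.inl (mem_sdiff.2 ⟨hx', hxX⟩)
      refine (card_le_card hsub).trans ((card_union_le _ _).trans (Nat.add_le_add_left ?_ _))
      refine (card_union_le _ _).trans (Nat.add_le_add ?_ ?_)
      · refine (card_union_le _ _).trans ?_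
        rw [card_product, card_product, mul_comm W.card, ← two_mul]
        gcongr
      · rw [card_product]
        gcongr
        exact hXW.trans sdiff_subset
    obtain ⟨w, hw⟩ := hW0
    have hWc : 2 * lam + 10 * q < 2 * W.card :=
      (h2 w hw).trans_le (Nat.mul_le_mul_left _ (card_le_card (filter_subset _ _)))
    have hR : ((W \ Br) \ X).card ≤ W.card :=
      card_le_card (sdiff_subset.trans sdiff_subset)
    have h4 : 2 * lam * ((W \ Br) \ X).card ≤ 2 * lam * W.card := Nat.mul_le_mul_left _ hR
    have h5 : (2 * lam + 10 * q) * q ≤ 2 * W.card * q := Nat.mul_le_mul_right _ hWc.le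
    have h6 : n * W.card ≤ q * W.card := Nat.mul_le_mul_right _ (by omega)
    have h7 : m * W.card ≤ q * W.card := Nat.mul_le_mul_right _ (by omega)
    nlinarith
  · intro D hD hDX
    by_cases hD0 : D = ∅
    · simp [hD0, touch_empty]
    exfalso
    obtain ⟨d, hd⟩ := nonempty_iff_ne_empty.2 hD0
    have hDWB : D ⊆ W \ Br := hD.trans sdiff_subset
    have hDW : D ⊆ W := hDWB.trans sdiff_subset
    have hbW : bdry J D ⊆ W \ Br := by
      intro v hv
      obtain ⟨-, e, -, h⟩ := mem_bdry.1 hv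
      exact h.2.2.1
    obtain ⟨x, hxX, hxD⟩ := exists_mem_notMem_of_card_lt_card hDX
    have hxDn : x ∉ D := fun h => (mem_sdiff.1 (hD h)).2 hxX
    have hxB := (mem_sdiff.1 (hXW hxX)).2
    have hxW := (mem_sdiff.1 (hXW hxX)).1
    set W₁ := (D ∪ bdry J D) ∪ Br with hW₁
    have hnb : ∀ a ∈ D, ∀ b ∈ W, G.Adj a b → b ∈ W₁ := by
      intro a ha b hb hab
      by_cases hbB : b ∈ Br
      · exact mem_union_right _ hbB
      by_cases hbD : b ∈ D
      · exact mem_union_left _ (mem_union_left _ hbD)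
      · exact mem_union_left _ (mem_union_right _ (mem_bdry.2
          ⟨hbD, a, ha, hJadj a b (hDWB ha) (mem_sdiff.2 ⟨hb, hbB⟩) hab⟩))
    have hW₁W : W₁ ⊆ W :=
      union_subset (union_subset hDW (hbW.trans sdiff_subset)) hBrW
    have hc₁ : (nbrIn G W d).card ≤ W₁.card := card_le_card fun b hb =>
      hnb d hd b (mem_nbrIn.1 hb).1 (mem_nbrIn.1 hb).2
    have hc₂ : (nbrIn G W x).card ≤ (W \ D).card := card_le_card fun b hb => by
      obtain ⟨hbW', hxb⟩ := mem_nbrIn.1 hb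
      refine mem_sdiff.2 ⟨hbW', fun hbD => hxD (mem_bdry.2 ⟨hxDn, b, hbD, ?_⟩)⟩
      exact hJadj b x (hDWB hbD) (hXW hxX) hxb.symm
    have hdd := h2 d (hDW hd)
    have hxx := h2 x hxW
    have e1 := h3 W₁ (hW₁W.ssubset_of_ne fun h => by
      have : x ∈ W₁ := h ▸ hxW
      simp [hW₁, hxDn, hxD, hxB] at this) (by omega)
    have e2 := h3 (W \ D) (sdiff_subset.ssubset_of_ne fun h => by
      have : d ∈ W \ D := by rw [h]; exact hDW hd
      exact (mem_sdiff.1 this).2 hd) (by omega)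
    have hp : pairs G W ≤ pairs G W₁ + pairs G (W \ D) := by
      refine (card_le_card ?_).trans (card_union_le _ _)
      rintro ⟨a, b⟩ hp
      simp only [mem_union, mem_filter, mem_univ, true_and, mem_sdiff] at hp ⊢
      by_cases ha : a ∈ D
      · exact Or.inl ⟨hp.1, mem_union_left _ (mem_union_left _ ha), hnb a ha b hp.2.2 hp.1⟩
      by_cases hb : b ∈ D
      · exact Or.inl ⟨hp.1, hnb b hb a hp.2.1 hp.1.symm,
          mem_union_left _ (mem_union_left _ hb)⟩
      · exact Or.inr ⟨hp.1, ⟨hp.2.1, ha⟩, hp.2.2, hb⟩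
    have hsum : W₁.card + (W \ D).card ≤ W.card + q := by
      have i1 : W₁.card ≤ _ := card_union_le (D ∪ bdry J D) Br
      have i2 := card_union_le D (bdry J D)
      have i3 := card_sdiff_add_card_eq_card hDW
      omega
    have := Nat.mul_le_mul_left (2 * lam + 10 * q) hsum
    rw [mul_add, mul_add] at this
    omega

/-- The terminals are private neighbours of the branch vertices, so linking the two terminals of
each edge of K_{s,t} in the rest of `W` yields the subdivided edges. -/
theorem exists_model_of_dense {G : SimpleGraph V} {s t q lam : ℕ} (hst : 1 ≤ s + t)
    (hq : q = 2 * (s * t) + (s + t)) (hlam : lam = 24 * (2 * (s * t)) + 2) {W₀ : Finset V}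
    (hW₀ : W₀.Nonempty) (hd : (2 * lam + 10 * q) * W₀.card ≤ pairs G W₀) :
    Nonempty (KstModel s t G) := by
  obtain ⟨W, hW0, h1, h2, h3⟩ := exists_mader (q := q) (by omega) (by omega) hW₀ hd
  have hWc : s + t ≤ W.card := by
    obtain ⟨w, hw⟩ := hW0
    have := h2 w hw
    have : (nbrIn G W w).card ≤ W.card := card_le_card (filter_subset _ _)
    omega
  obtain ⟨β⟩ : Nonempty (Fin s ⊕ Fin t ↪ W) :=
    Function.Embedding.nonempty_of_card_le (by simpa using hWc)
  let b : Fin s ⊕ Fin t → V := fun k => β k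
  have hb : Function.Injective b := Subtype.val_injective.comp β.injective
  let Br : Finset V := univ.image b
  have hBrc : Br.card ≤ s + t := card_image_le.trans (by simp)
  have hbBr : ∀ k, b k ∈ Br := fun k => mem_image_of_mem _ (mem_univ _)
  have hBrW : Br ⊆ W := by
    intro v hv
    obtain ⟨k, -, rfl⟩ := mem_image.1 hv
    exact (β k).2
  -- `o` gives the branch vertex at each of the `2 * (s * t)` edge ends. Minimum degree and Hall's
  -- theorem then give distinct terminals `τ` outside `Br`.
  let o : (Fin s × Fin t) ⊕ (Fin s × Fin t) → V :=
    Sum.elim (fun k => b (.inl k.1)) fun k => b (.inr k.2)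
  have ho : ∀ k, o k ∈ W := by
    rintro (k | k) <;> exact (β _).2
  obtain ⟨τ, hτ, hτN⟩ := (all_card_le_biUnion_card_iff_exists_injective
    (fun k => nbrIn G W (o k) \ Br)).1 (by
    intro A
    rcases A.eq_empty_or_nonempty with rfl | ⟨k, hk⟩
    · simp
    · have e1 : A.card ≤ 2 * (s * t) := by
        refine A.card_le_univ.trans ?_
        simp; omega
      have e2 := card_le_card (subset_biUnion_of_mem (fun k => nbrIn G W (o k) \ Br) hk)
      have e3 : (nbrIn G W (o k)).card ≤ (nbrIn G W (o k) \ Br).card + Br.card :=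
        card_le_card_sdiff_add_card
      have e4 := h2 (o k) (ho k)
      omega)
  let X : Finset V := univ.image τ
  have hXc : X.card ≤ 2 * (s * t) := card_image_le.trans (by simp; omega)
  have hτX : ∀ k, τ k ∈ X := fun k => mem_image_of_mem _ (mem_univ _)
  have hXW : X ⊆ W \ Br := by
    intro v hv
    obtain ⟨k, -, rfl⟩ := mem_image.1 hv
    obtain ⟨h4, h5⟩ := mem_sdiff.1 (hτN k)
    exact mem_sdiff.2 ⟨(mem_nbrIn.1 h4).1, h5⟩
  have hL := (massed_of_mader (n := s + t) hq.ge hW0 h1 h2 h3 hBrc hBrW hXc hXW).linked hlam.ge hXc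
  rw [Linked, sdiff_union_of_subset hXW] at hL
  let lab : (Fin s × Fin t) ⊕ (Fin s × Fin t) → ℕ :=
    Sum.elim (fun k => Encodable.encode k) fun k => Encodable.encode k
  -- The two terminals of an edge share a label that no other edge has. The default 0 occurs only
  -- outside `X`, where the prescribed label is irrelevant.
  obtain ⟨l, hl, hr⟩ := hL (fun x => if h : ∃ k, τ k = x then lab h.choose else 0)
  have hc : ∀ k, (if h : ∃ k', τ k' = τ k then lab h.choose else 0) = lab k := by
    intro k
    have h : ∃ k', τ k' = τ k := ⟨k, rfl⟩
    rw [dif_pos h, hτ h.choose_spec]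
  have hlτ : ∀ k, l (τ k) = lab k := fun k => (hl _ (hτX k)).trans (hc k)
  let C : Fin s → Fin t → Finset V := fun i j =>
    {b (.inl i), b (.inr j)} ∪ (W \ Br).filter fun v => l v = Encodable.encode (i, j)
  have hmemC : ∀ i j x, x ∈ C i j ↔ (x = b (.inl i) ∨ x = b (.inr j)) ∨
      (x ∈ W \ Br ∧ l x = Encodable.encode (i, j)) := by
    intro i j x
    rw [mem_union, mem_filter, mem_insert, mem_singleton]
  have hbC : ∀ i j k, b k ∈ C i j → k = .inl i ∨ k = .inr j := by
    intro i j k hk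
    rcases (hmemC _ _ _).1 hk with (h | h) | h
    · exact Or.inl (hb h)
    · exact Or.inr (hb h)
    · exact absurd (hbBr k) (mem_sdiff.1 h.1).2
  refine ⟨⟨fun i => b (.inl i), fun j => b (.inr j), C, fun i i' h => Sum.inl_injective (hb h),
    fun j j' h => Sum.inr_injective (hb h), fun i j h => by simpa using hb h, ?_, ?_, ?_, ?_⟩⟩
  · intro i j
    have hX1 : τ (.inl (i, j)) ∈ C i j := (hmemC _ _ _).2 (Or.inr ⟨hXW (hτX _), hlτ _⟩)
    have hX2 : τ (.inr (i, j)) ∈ C i j := (hmemC _ _ _).2 (Or.inr ⟨hXW (hτX _), hlτ _⟩)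
    have a1 : (mono G (C i j) fun _ => 0).Adj (b (.inl i)) (τ (.inl (i, j))) :=
      ⟨(mem_nbrIn.1 (mem_sdiff.1 (hτN (.inl (i, j)))).1).2, (hmemC _ _ _).2 (by simp), hX1, rfl⟩
    have a2 : (mono G (C i j) fun _ => 0).Adj (b (.inr j)) (τ (.inr (i, j))) :=
      ⟨(mem_nbrIn.1 (mem_sdiff.1 (hτN (.inr (i, j)))).1).2, (hmemC _ _ _).2 (by simp), hX2, rfl⟩
    refine a1.reachable.trans (SimpleGraph.Reachable.trans ?_ a2.symm.reachable)
    have hreach := hr _ (hτX (.inl (i, j))) _ (hτX (.inr (i, j)))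
      ((hc _).trans (hc (.inr (i, j))).symm)
    set F := mono (mono G (W \ Br) fun _ => 0) (W \ Br) l with hF
    have key : ∀ y, F.Reachable (τ (.inl (i, j))) y →
        (mono G (C i j) fun _ => 0).Reachable (τ (.inl (i, j))) y := by
      rintro y ⟨p⟩
      have hp : ∀ v ∈ p.support, v ∈ C i j := by
        intro v hv
        have hrv := (p.takeUntil v hv).reachable
        have hlv := eq_of_reachable (l := l) (fun a b (h : F.Adj a b) => h.2.2.2) hrv
        by_cases hvx : v = τ (.inl (i, j))
        · exact hvx ▸ hX1
        · obtain ⟨z, hz⟩ := exists_adj_of_reachable_ne hrv.symm hvx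
          exact (hmemC _ _ _).2 (Or.inr ⟨hz.2.1, hlv.symm.trans (hlτ _)⟩)
      exact reachable_support (fun a b (h : F.Adj a b) => h.1.1) p _ hp
    exact key _ hreach
  · intro i j i' h
    simpa using hbC i j _ h
  · intro i j j' h
    simpa using hbC i j _ h
  · intro i j i' j' hne x hx hx'
    rcases (hmemC _ _ _).1 hx with (h | h) | h
    · exact Or.inl ⟨i, h.symm⟩
    · exact Or.inr ⟨j, h.symm⟩
    · rcases (hmemC _ _ _).1 hx' with (h' | h') | h'
      · exact Or.inl ⟨i', h'.symm⟩
      · exact Or.inr ⟨j', h'.symm⟩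
      · exact absurd (Encodable.encode_injective (h.2.symm.trans h'.2)) hne

end

/-! ### Light edges and choosability -/

noncomputable section

variable {V : Type u}

/-- A model in `D` yields a model in `G` if `G` contains a 1-subdivision of `D`. -/
theorem KstModel.of_subdivision {s t : ℕ} {G D : SimpleGraph V} {B : Finset V}
    [Fintype V] {M : Finset (V × Sym2 V)} (hD : ∀ x y, D.Adj x y → ∃ a, (a, s(x, y)) ∈ M)
    (hB : ∀ a x y, (a, s(x, y)) ∈ M → x ≠ y ∧ a ∉ B ∧ x ∈ B ∧ y ∈ B ∧ G.Adj a x ∧ G.Adj a y)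
    (hM : ∀ a e e', (a, e) ∈ M → (a, e') ∈ M → e = e') (N : KstModel s t D) :
    Nonempty (KstModel s t G) := by
  have hDB : ∀ x y, D.Adj x y → x ∈ B := by
    intro x y hxy
    obtain ⟨a, ha⟩ := hD x y hxy
    exact (hB a x y ha).2.2.1
  let C : Fin s → Fin t → Finset V := fun i j => ((N.C i j).filter fun x => x ∈ B) ∪
    univ.filter fun a => ∃ e, (a, e) ∈ M ∧ ∀ x ∈ e, x ∈ N.C i j
  have hC : ∀ i j x, x ∈ C i j ↔ (x ∈ N.C i j ∧ x ∈ B) ∨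
      ∃ e, (x, e) ∈ M ∧ ∀ y ∈ e, y ∈ N.C i j := by
    intro i j x
    rw [mem_union, mem_filter, mem_filter]; simp
  have hMB : ∀ a e, (a, e) ∈ M → a ∉ B := by
    rintro a ⟨x, y⟩ h
    exact (hB a x y h).2.1
  have hCB : ∀ i j x, x ∈ C i j → x ∈ B → x ∈ N.C i j := by
    intro i j x hx hxB
    rcases (hC i j x).1 hx with h | ⟨e, h, -⟩
    · exact h.1
    · exact absurd hxB (hMB x e h)
  have hfB : ∀ (i : Fin s) (j : Fin t), N.f i ∈ B := by
    intro i j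
    obtain ⟨z, hz⟩ := exists_adj_of_reachable_ne (N.reach i j) (N.f_ne_g i j)
    exact hDB _ _ hz.1
  have hgB : ∀ (i : Fin s) (j : Fin t), N.g j ∈ B := by
    intro i j
    obtain ⟨z, hz⟩ := exists_adj_of_reachable_ne (N.reach i j).symm (N.f_ne_g i j).symm
    exact hDB _ _ hz.1
  refine ⟨⟨N.f, N.g, C, N.f_inj, N.g_inj, N.f_ne_g, ?_, ?_, ?_, ?_⟩⟩
  · intro i j
    refine reachable_of_adj (fun x y hxy => ?_) (N.reach i j)
    obtain ⟨hadj, hx, hy, -⟩ := hxy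
    obtain ⟨a, ha⟩ := hD x y hadj
    obtain ⟨-, -, hxB, hyB, hax, hay⟩ := hB a x y ha
    have haC : a ∈ C i j := (hC _ _ _).2 (Or.inr ⟨_, ha, fun z hz => by
      rcases Sym2.mem_iff.1 hz with rfl | rfl <;> assumption⟩)
    have h1 : (mono G (C i j) fun _ => 0).Adj a x :=
      ⟨hax, haC, (hC _ _ _).2 (Or.inl ⟨hx, hxB⟩), rfl⟩
    have h2 : (mono G (C i j) fun _ => 0).Adj a y :=
      ⟨hay, haC, (hC _ _ _).2 (Or.inl ⟨hy, hyB⟩), rfl⟩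
    exact h1.symm.reachable.trans h2.reachable
  · exact fun i j i' h => N.f_mem i j i' (hCB _ _ _ h (hfB i' j))
  · exact fun i j j' h => N.g_mem i j j' (hCB _ _ _ h (hgB i j'))
  · intro i j i' j' hne x hx hx'
    by_cases hxB : x ∈ B
    · exact N.inter i j i' j' hne x (hCB _ _ _ hx hxB) (hCB _ _ _ hx' hxB)
    exfalso
    obtain ⟨e, he, heC⟩ := ((hC i j x).1 hx).resolve_left fun h => hxB h.2
    obtain ⟨e', he', heC'⟩ := ((hC i' j' x).1 hx').resolve_left fun h => hxB h.2
    obtain rfl := hM x e e' he he'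
    induction e using Sym2.ind with
    | _ y z =>
    have hyz := (hB x y z he).1
    -- Both ends of an edge whose subdivision vertex is shared lie in both sets, so each is a branch
    -- vertex common to `(i, j)` and `(i', j')`. Two distinct such ends force the pairs to coincide.
    have hkey : ∀ w ∈ s(y, z), (w = N.f i ∧ i = i') ∨ (w = N.g j ∧ j = j') := by
      intro w hw
      rcases N.inter i j i' j' hne w (heC w hw) (heC' w hw) with ⟨k, rfl⟩ | ⟨k, rfl⟩
      · have h1 := N.f_mem _ _ _ (heC _ hw)
        have h2 := N.f_mem _ _ _ (heC' _ hw)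
        subst h1; exact Or.inl ⟨rfl, h2⟩
      · have h1 := N.g_mem _ _ _ (heC _ hw)
        have h2 := N.g_mem _ _ _ (heC' _ hw)
        subst h1; exact Or.inr ⟨rfl, h2⟩
    rcases hkey y (Sym2.mem_mk_left y z) with ⟨h1, h2⟩ | ⟨h1, h2⟩ <;>
    rcases hkey z (Sym2.mem_mk_right y z) with ⟨h3, h4⟩ | ⟨h3, h4⟩
    · exact hyz (h1.trans h3.symm)
    · exact hne (by rw [h2, h4])
    · exact hne (by rw [h2, h4])
    · exact hyz (h1.trans h3.symm)

/-- `K_{s,t}` as a subgraph is a model. -/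
theorem KstModel.of_common_nbrs {s t : ℕ} {G : SimpleGraph V} {S T : Finset V} (hS : S.card = s)
    (hT : t ≤ T.card) (h : ∀ x ∈ S, ∀ y ∈ T, G.Adj x y) : Nonempty (KstModel s t G) := by
  obtain ⟨α⟩ : Nonempty (Fin s ↪ S) := Function.Embedding.nonempty_of_card_le (by simp [hS])
  obtain ⟨β⟩ : Nonempty (Fin t ↪ T) := Function.Embedding.nonempty_of_card_le (by simpa using hT)
  have hadj : ∀ i j, G.Adj (α i) (β j) := fun i j => h _ (α i).2 _ (β j).2
  have hα : ∀ i i', (α i : V) = α i' → i = i' := fun i i' h => α.injective (Subtype.ext h)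
  have hβ : ∀ i i', (β i : V) = β i' → i = i' := fun i i' h => β.injective (Subtype.ext h)
  have hne : ∀ i j, (α i : V) ≠ β j := fun i j => (hadj i j).ne
  refine ⟨⟨fun i => α i, fun j => β j, fun i j => {(α i : V), (β j : V)}, fun i i' => hα i i',
    fun j j' => hβ j j', hne, fun i j => ?_, fun i j i' hi => ?_, fun i j j' hj => ?_,
    fun i j i' j' _ x hx _ => ?_⟩⟩
  · exact SimpleGraph.Adj.reachable ⟨hadj i j, by simp, by simp, rfl⟩
  · rw [mem_insert, mem_singleton] at hi
    exact hα _ _ (hi.resolve_right (hne _ _))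
  · rw [mem_insert, mem_singleton] at hj
    exact hβ _ _ (hj.resolve_left (hne _ _).symm)
  · rw [mem_insert, mem_singleton] at hx
    exact hx.imp (fun h => ⟨i, h.symm⟩) fun h => ⟨j, h.symm⟩

theorem KstModel.map_le {s t : ℕ} {G G' : SimpleGraph V} (h : G ≤ G') (N : KstModel s t G) :
    Nonempty (KstModel s t G') :=
  ⟨⟨N.f, N.g, N.C, N.f_inj, N.g_inj, N.f_ne_g,
    fun i j => (N.reach i j).mono (mono_mono h subset_rfl _), N.f_mem, N.g_mem, N.inter⟩⟩

/-- More than `t` vertices with the same `s`-set of neighbours would span a K_{s,t} with it. -/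
theorem card_le_mul_of_common_nbrs {s t : ℕ} {G : SimpleGraph V} (hG : IsEmpty (KstModel s t G))
    {A : Finset V} {Q : Finset (Finset V)} {κ : V → Finset V} (hs : ∀ a ∈ A, (κ a).card = s)
    (hκ : ∀ a ∈ A, κ a ∈ Q) (h : ∀ a ∈ A, ∀ x ∈ κ a, G.Adj a x) : A.card ≤ t * Q.card := by
  refine card_le_mul_card_image_of_maps_to hκ t fun K _ => ?_
  by_contra hcon
  push Not at hcon
  obtain ⟨a, ha⟩ := card_pos.1 (Nat.zero_lt_of_lt hcon)
  obtain ⟨ha1, ha2⟩ := mem_filter.1 ha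
  refine not_nonempty_iff.2 hG (KstModel.of_common_nbrs (S := K) (ha2 ▸ hs a ha1) hcon.le
    fun x hx y hy => ?_)
  obtain ⟨hy1, hy2⟩ := mem_filter.1 hy
  exact (h y hy1 x (hy2 ▸ hx)).symm

variable [Fintype V]

theorem sum_nbrIn_le_pairs {G : SimpleGraph V} {B W : Finset V} (hBW : B ⊆ W) :
    ∑ v ∈ B, (nbrIn G W v).card ≤ pairs G W := by
  rw [← card_sigma]
  refine card_le_card_of_injOn (fun p => (p.1, p.2)) ?_ ?_
  · rintro ⟨a, b⟩ hp
    simp only [coe_sigma, Set.mem_sigma_iff, mem_coe, mem_nbrIn] at hp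
    simp only [coe_filter, mem_univ, true_and, Set.mem_ofPred_eq]
    exact ⟨hp.2.2, hBW hp.1, hp.2.1⟩
  · rintro ⟨a, b⟩ - ⟨a', b'⟩ - heq
    simp only [Prod.mk.injEq] at heq
    obtain ⟨rfl, rfl⟩ := heq
    rfl

/-- The cliques of `D` on `s` vertices of `W`. -/
def cliques (D : SimpleGraph V) (s : ℕ) (W : Finset V) : Finset (Finset V) :=
  (W.powersetCard s).filter fun K => ∀ x ∈ K, ∀ y ∈ K, x ≠ y → D.Adj x y

/-- Sparsity gives a vertex of degree at most `Γ` in `W`. It lies in at most `Γ ^ (s - 1)` of the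
cliques and can then be deleted. -/
theorem card_cliques_le {D : SimpleGraph V} {Γ s : ℕ} (hs : 1 ≤ s)
    (h : ∀ W : Finset V, W.Nonempty → pairs D W < Γ * W.card) (W : Finset V) :
    (cliques D s W).card ≤ W.card * Γ ^ (s - 1) := by
  induction hn : W.card using Nat.strong_induction_on generalizing W with
  | _ n ih =>
  subst hn
  rcases W.eq_empty_or_nonempty with rfl | hW
  · rw [cliques, powersetCard_eq_empty.2 (show (∅ : Finset V).card < s by rw [card_empty]; omega)]
    simp
  obtain ⟨v, hv, hdeg⟩ : ∃ v ∈ W, (nbrIn D W v).card ≤ Γ := by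
    by_contra hcon
    push Not at hcon
    have h1 := card_nsmul_le_sum W (fun v => (nbrIn D W v).card) Γ fun v hv => (hcon v hv).le
    have h2 := sum_nbrIn_le_pairs (G := D) (subset_refl W)
    have h3 := h W hW
    rw [smul_eq_mul, mul_comm] at h1
    omega
  have hcard := card_erase_add_one hv
  have hsub : cliques D s W ⊆ cliques D s (W.erase v) ∪
      ((nbrIn D W v).powersetCard (s - 1)).image (insert v) := by
    intro K hK
    obtain ⟨hK1, hK2⟩ := mem_filter.1 hK
    obtain ⟨hKW, hKc⟩ := mem_powersetCard.1 hK1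
    by_cases hvK : v ∈ K
    · refine mem_union_right _ (mem_image.2 ⟨K.erase v, mem_powersetCard.2 ⟨?_, ?_⟩,
        insert_erase hvK⟩)
      · intro x hx
        obtain ⟨hxv, hxK⟩ := mem_erase.1 hx
        exact mem_nbrIn.2 ⟨hKW hxK, hK2 v hvK x hxK hxv.symm⟩
      · rw [card_erase_of_mem hvK, hKc]
    · refine mem_union_left _ (mem_filter.2 ⟨mem_powersetCard.2 ⟨fun x hx => ?_, hKc⟩, hK2⟩)
      exact mem_erase.2 ⟨fun h => hvK (h ▸ hx), hKW hx⟩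
  have h1 := (card_le_card hsub).trans (card_union_le _ _)
  have h2 := ih _ (by omega) (W.erase v) rfl
  have h3 : (((nbrIn D W v).powersetCard (s - 1)).image (insert v)).card ≤ Γ ^ (s - 1) := by
    refine card_image_le.trans ?_
    rw [card_powersetCard]
    exact (Nat.choose_le_pow _ _).trans (Nat.pow_le_pow_left hdeg _)
  rw [← hcard, add_mul, one_mul]
  omega

/-- A maximal 1-subdivision in `G` of a graph on `B` with subdivision vertices in `A`. -/
theorem exists_maximal_subdivision {G : SimpleGraph V} {s t : ℕ} {A B : Finset V}
    (hG : IsEmpty (KstModel s t G)) (hAB : ∀ a ∈ A, ∀ x, G.Adj a x → x ∈ B)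
    (hdisj : ∀ a ∈ A, a ∉ B) :
    ∃ (D : SimpleGraph V) (A₁ : Finset V), IsEmpty (KstModel s t D) ∧ A₁.card ≤ pairs D B ∧
      ∀ a ∈ A \ A₁, ∀ x y, G.Adj a x → G.Adj a y → x ≠ y → D.Adj x y := by
  -- A pair `(a, e)` means that `a` subdivides `e`; no vertex serves two edges and no edge is
  -- subdivided twice. In a largest such set, a missing edge between two neighbours of an unused
  -- vertex could be added.
  let Good : Finset (V × Sym2 V) → Prop := fun M =>
    (∀ a x y, (a, s(x, y)) ∈ M → x ≠ y ∧ a ∈ A ∧ G.Adj a x ∧ G.Adj a y) ∧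
    (∀ a e e', (a, e) ∈ M → (a, e') ∈ M → e = e') ∧
    ∀ a a' e, (a, e) ∈ M → (a', e) ∈ M → a = a'
  obtain ⟨M, hM, hmax⟩ := exists_max_image (univ.filter Good) card
    ⟨∅, mem_filter.2 ⟨mem_univ _, by simp [Good]⟩⟩
  obtain ⟨hM1, hM2, hM3⟩ := (mem_filter.1 hM).2
  let D : SimpleGraph V :=
    { Adj := fun x y => ∃ a, (a, s(x, y)) ∈ M
      symm := ⟨fun x y ⟨a, h⟩ => ⟨a, Sym2.eq_swap ▸ h⟩⟩
      loopless := ⟨fun x ⟨a, h⟩ => (hM1 a x x h).1 rfl⟩ }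
  have hD : IsEmpty (KstModel s t D) := by
    rw [← not_nonempty_iff]
    rintro ⟨N⟩
    refine not_nonempty_iff.2 hG (N.of_subdivision (B := B) (M := M) (fun x y h => h) ?_ hM2)
    intro a x y h
    obtain ⟨h1, h2, h3, h4⟩ := hM1 a x y h
    exact ⟨h1, hdisj a h2, hAB a h2 x h3, hAB a h2 y h4, h3, h4⟩
  have hMc : M.card ≤ pairs D B := by
    have hout : ∀ e : Sym2 V, s((Quot.out e).1, (Quot.out e).2) = e := fun e => Quot.out_eq e
    refine card_le_card_of_injOn (fun p => Quot.out p.2) ?_ ?_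
    · rintro ⟨a, e⟩ hp
      have hp' : (a, s((Quot.out e).1, (Quot.out e).2)) ∈ M := by rw [hout]; exact hp
      obtain ⟨h1, h2, h3, h4⟩ := hM1 a _ _ hp'
      simp only [coe_filter, mem_univ, true_and, Set.mem_ofPred_eq]
      exact ⟨⟨a, hp'⟩, hAB a h2 _ h3, hAB a h2 _ h4⟩
    · rintro ⟨a, e⟩ hp ⟨a', e'⟩ hp' heq
      have h1 : e = e' := by
        rw [← hout e, ← hout e']
        simp only at heq
        rw [heq]
      subst h1
      rw [hM3 a a' e hp hp']
  refine ⟨D, M.image Prod.fst, hD, card_image_le.trans hMc, ?_⟩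
  intro a ha x y hax hay hxy
  by_contra hnot
  obtain ⟨haA, haA₁⟩ := mem_sdiff.1 ha
  have haM : ∀ e, (a, e) ∉ M := fun e h => haA₁ (mem_image_of_mem Prod.fst h)
  have heM : ∀ a', (a', s(x, y)) ∉ M := fun a' h => hnot ⟨a', h⟩
  have hgood : Good (insert (a, s(x, y)) M) := by
    refine ⟨?_, ?_, ?_⟩
    · intro a' x' y' h
      rcases mem_insert.1 h with h | h
      · obtain ⟨rfl, h'⟩ := Prod.mk.inj h
        rcases Sym2.eq_iff.1 h' with ⟨rfl, rfl⟩ | ⟨rfl, rfl⟩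
        · exact ⟨hxy, haA, hax, hay⟩
        · exact ⟨hxy.symm, haA, hay, hax⟩
      · exact hM1 a' x' y' h
    · intro a' e e' h h'
      rcases mem_insert.1 h with h | h <;> rcases mem_insert.1 h' with h' | h'
      · rw [(Prod.mk.inj h).2, (Prod.mk.inj h').2]
      · exact absurd ((Prod.mk.inj h).1 ▸ h') (haM e')
      · exact absurd ((Prod.mk.inj h').1 ▸ h) (haM e)
      · exact hM2 a' e e' h h'
    · intro a' a'' e h h'
      rcases mem_insert.1 h with h | h <;> rcases mem_insert.1 h' with h' | h'
      · rw [(Prod.mk.inj h).1, (Prod.mk.inj h').1]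
      · exact absurd ((Prod.mk.inj h).2 ▸ h') (heM a'')
      · exact absurd ((Prod.mk.inj h').2 ▸ h) (heM a')
      · exact hM3 a' a'' e h h'
  have := hmax _ (mem_filter.2 ⟨mem_univ _, hgood⟩)
  rw [card_insert_of_notMem (haM _)] at this
  omega

/-- Without a light edge, counting pairs at `B` gives `n * B.card < Γ * (A.card + B.card)`. But at
most `Γ * B.card` vertices of `A` serve as subdivision vertices, and each of the others is adjacent
to all of one of at most `B.card * Γ ^ (s - 1)` cliques of `D`, each clique being used at most `t`
times. -/
theorem exists_light_edge {G : SimpleGraph V} {s t Γ n : ℕ} (hs : 1 ≤ s)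
    (hΓ : ∀ D : SimpleGraph V, IsEmpty (KstModel s t D) →
      ∀ W : Finset V, W.Nonempty → pairs D W < Γ * W.card)
    (hG : IsEmpty (KstModel s t G)) (hdeg : ∀ v w, G.Adj v w → s ≤ (nbrIn G univ v).card)
    (he : ∃ a b, G.Adj a b) (hn : Γ * (Γ + t * Γ ^ (s - 1) + 1) ≤ n) :
    ∃ a b, G.Adj a b ∧ (nbrIn G univ a).card ≤ n ∧ (nbrIn G univ b).card ≤ n := by
  by_contra hno
  push Not at hno
  set A : Finset V := univ.filter fun v => (∃ w, G.Adj v w) ∧ (nbrIn G univ v).card ≤ n with hA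
  set B : Finset V := univ.filter fun v => n < (nbrIn G univ v).card with hB
  have hAB : ∀ a ∈ A, ∀ x, G.Adj a x → x ∈ B := by
    intro a ha x hax
    exact mem_filter.2 ⟨mem_univ _, hno a x hax (mem_filter.1 ha).2.2⟩
  have hdisj : ∀ a ∈ A, a ∉ B := fun a ha hb =>
    absurd (mem_filter.1 ha).2.2 (not_le.2 (mem_filter.1 hb).2)
  have hB0 : B.Nonempty := by
    obtain ⟨a, b, hab⟩ := he
    by_cases ha : (nbrIn G univ a).card ≤ n
    · exact ⟨b, mem_filter.2 ⟨mem_univ _, hno a b hab ha⟩⟩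
    · exact ⟨a, mem_filter.2 ⟨mem_univ _, not_le.1 ha⟩⟩
  have hmemAB : ∀ a b, G.Adj a b → a ∈ A ∪ B := by
    intro a b hab
    by_cases ha : (nbrIn G univ a).card ≤ n
    · exact mem_union_left _ (mem_filter.2 ⟨mem_univ _, ⟨b, hab⟩, ha⟩)
    · exact mem_union_right _ (mem_filter.2 ⟨mem_univ _, not_le.1 ha⟩)
  have hlow : n * B.card < Γ * (A.card + B.card) := by
    have h1 := hΓ G hG (A ∪ B) (hB0.mono subset_union_right)
    have h2 := sum_nbrIn_le_pairs (G := G) (subset_union_right : B ⊆ A ∪ B)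
    have h3 : B.card * n ≤ ∑ v ∈ B, (nbrIn G (A ∪ B) v).card := by
      rw [← smul_eq_mul]
      refine card_nsmul_le_sum _ _ _ fun v hv => ?_
      refine (mem_filter.1 hv).2.le.trans (card_le_card fun x hx => ?_)
      exact mem_nbrIn.2 ⟨hmemAB x v (mem_nbrIn.1 hx).2.symm, (mem_nbrIn.1 hx).2⟩
    have h4 := Nat.mul_le_mul_left Γ (card_union_le A B)
    rw [mul_comm n]
    omega
  obtain ⟨D, A₁, hD, hA₁, hcl⟩ := exists_maximal_subdivision hG hAB hdisj
  have hMc : A₁.card ≤ Γ * B.card := hA₁.trans (hΓ D hD B hB0).le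
  have hK : ∀ a ∈ A \ A₁, ∃ K ∈ cliques D s B, ∀ x ∈ K, G.Adj a x := by
    intro a ha
    have haA := (mem_sdiff.1 ha).1
    obtain ⟨w, hw⟩ := (mem_filter.1 haA).2.1
    obtain ⟨K, hK, hKc⟩ := exists_subset_card_eq (hdeg a w hw)
    have hKa : ∀ x ∈ K, G.Adj a x := fun x hx => (mem_nbrIn.1 (hK hx)).2
    exact ⟨K, mem_filter.2 ⟨mem_powersetCard.2 ⟨fun x hx => hAB a haA x (hKa x hx), hKc⟩,
      fun x hx y hy hxy => hcl a ha x y (hKa x hx) (hKa y hy) hxy⟩, hKa⟩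
  choose! κ hκ hκG using hK
  have hA₂ : (A \ A₁).card ≤ t * (cliques D s B).card :=
    card_le_mul_of_common_nbrs hG (fun a ha => (mem_powersetCard.1 (mem_filter.1 (hκ a ha)).1).2)
      hκ hκG
  have hcli := card_cliques_le hs (hΓ D hD) B
  have hAc : A.card ≤ (A \ A₁).card + A₁.card := card_le_card_sdiff_add_card
  have h1 : A.card + B.card ≤ (Γ + t * Γ ^ (s - 1) + 1) * B.card := by
    have := Nat.mul_le_mul_left t hcli
    calc A.card + B.card ≤ t * (B.card * Γ ^ (s - 1)) + Γ * B.card + B.card := by omega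
      _ = _ := by ring
  have h2 := Nat.mul_le_mul_left Γ h1
  have h3 := Nat.mul_le_mul_right B.card hn
  rw [← mul_assoc] at h2
  omega

/-- Induction on the edges of subgraphs. Restoring a light edge affects only its ends, whose degree
is at most `n`. A vertex with fewer than `s` neighbours is isolated and later recoloured with a
colour of its list that they do not use. -/
theorem choosable_of_light {G : SimpleGraph V} {s n : ℕ} (hs : 1 ≤ s)
    (h : ∀ H ≤ G, (∀ v w, H.Adj v w → s ≤ (nbrIn H univ v).card) → (∃ a b, H.Adj a b) →
      ∃ a b, H.Adj a b ∧ (nbrIn H univ a).card ≤ n ∧ (nbrIn H univ b).card ≤ n) :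
    IsChoosable G s n := by
  intro α L hL
  suffices key : ∀ H ≤ G, ∃ c : V → α, (∀ x, c x ∈ L x) ∧ HasDefect H c n from key G le_rfl
  intro H
  induction hm : pairs H univ using Nat.strong_induction_on generalizing H with
  | _ m ih =>
  subst hm
  intro hHG
  have hlt : ∀ H' : SimpleGraph V, H' ≤ H → ∀ a b, H.Adj a b → ¬ H'.Adj a b →
      pairs H' univ < pairs H univ := by
    intro H' hle a b hab hab'
    apply card_lt_card
    refine ⟨fun p hp => ?_, fun hsub => ?_⟩
    · simp only [mem_filter, mem_univ, true_and, and_true] at hp ⊢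
      exact hle hp
    · have := @hsub (a, b) (mem_filter.2 ⟨mem_univ _, hab, mem_univ _, mem_univ _⟩)
      simp only [mem_filter, mem_univ, true_and, and_true] at this
      exact hab' this
  by_cases he : ∃ a b, H.Adj a b
  · by_cases hdeg : ∀ v w, H.Adj v w → s ≤ (nbrIn H univ v).card
    · obtain ⟨a, b, hab, ha, hb⟩ := h H hHG hdeg he
      obtain ⟨H', hadj⟩ : ∃ H' : SimpleGraph V, ∀ x y, H'.Adj x y ↔
          H.Adj x y ∧ s(x, y) ≠ s(a, b) := ⟨H.deleteEdges {s(a, b)}, by simp⟩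
      have hle : H' ≤ H := fun x y hxy => ((hadj x y).1 hxy).1
      obtain ⟨c, hc, hd⟩ := ih _ (hlt H' hle a b hab fun h' => ((hadj a b).1 h').2 rfl) H' rfl
        (hle.trans hHG)
      refine ⟨c, hc, fun x => ?_⟩
      have hsmall : (nbrIn H univ x).card ≤ n →
          {y | H.Adj x y ∧ c y = c x}.encard ≤ n := by
        intro hx
        calc {y | H.Adj x y ∧ c y = c x}.encard ≤ (nbrIn H univ x : Set V).encard :=
              Set.encard_le_encard fun y hy => by
                rw [mem_coe]; exact mem_nbrIn.2 ⟨mem_univ _, hy.1⟩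
          _ = ((nbrIn H univ x).card : ℕ∞) := Set.encard_coe_eq_coe_finsetCard _
          _ ≤ n := by exact_mod_cast hx
      by_cases hxa : x = a
      · exact hsmall (hxa ▸ ha)
      by_cases hxb : x = b
      · exact hsmall (hxb ▸ hb)
      refine (Set.encard_le_encard fun y hy => ?_).trans (hd x)
      refine ⟨(hadj x y).2 ⟨hy.1, fun heq => ?_⟩, hy.2⟩
      rcases Sym2.eq_iff.1 heq with ⟨h1, -⟩ | ⟨h1, -⟩
      · exact hxa h1
      · exact hxb h1
    · push Not at hdeg
      obtain ⟨v, w, hvw, hv⟩ := hdeg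
      have hle : avoid H {v} ≤ H := fun x y hxy => hxy.1
      obtain ⟨c, hc, hd⟩ := ih _ (hlt _ hle v w hvw fun h' => h'.2.1 (mem_singleton_self v)) _ rfl
        (hle.trans hHG)
      obtain ⟨k, hk, hk'⟩ := exists_mem_notMem_of_card_lt_card
        (show ((nbrIn H univ v).image c).card < (L v).card by
          rw [hL]; exact card_image_le.trans_lt hv)
      have hkc : ∀ y, H.Adj v y → c y ≠ k := fun y hy hyk =>
        hk' (mem_image.2 ⟨y, mem_nbrIn.2 ⟨mem_univ _, hy⟩, hyk⟩)
      refine ⟨Function.update c v k, fun x => ?_, fun x => ?_⟩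
      · by_cases hx : x = v
        · subst hx; rwa [Function.update_self]
        · rw [Function.update_of_ne hx]; exact hc x
      · by_cases hx : x = v
        · subst hx
          refine le_of_eq_of_le (Set.encard_eq_zero.2 ?_) (zero_le)
          refine Set.eq_empty_of_forall_notMem fun y hy => ?_
          have h2 := hy.2
          rw [Function.update_self, Function.update_of_ne hy.1.ne'] at h2
          exact hkc y hy.1 h2
        · refine (Set.encard_le_encard fun y hy => ?_).trans (hd x)
          obtain ⟨h1, h2⟩ := hy
          rw [Function.update_of_ne hx] at h2
          have hy : y ≠ v := by
            rintro rfl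
            rw [Function.update_self] at h2
            exact hkc x h1.symm h2.symm
          rw [Function.update_of_ne hy] at h2
          exact ⟨⟨h1, by simpa using hx, by simpa using hy⟩, h2⟩
  · push Not at he
    have hne : ∀ x, (L x).Nonempty := fun x => card_pos.1 (by rw [hL]; omega)
    refine ⟨fun x => (hne x).choose, fun x => (hne x).choose_spec, fun x => ?_⟩
    simp [he]

end

noncomputable section

/-! ### Lower bound: closures of trees -/

section LowerBound

variable {V : Type u}

theorem exists_disjoint_of_card_lt {k : ℕ} {Z : Finset V} (hZ : Z.card < k) (S : Fin k → V → Prop)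
    (hS : ∀ i i' x, S i x → S i' x → i = i') : ∃ i, ∀ z ∈ Z, ¬ S i z := by
  by_contra h
  push Not at h
  choose z hz hzS using h
  have := card_le_card_of_injOn (s := univ) z (fun i _ => hz i)
    fun i _ i' _ (heq : z i = z i') => hS i i' (z i) (hzS i) (heq ▸ hzS i')
  rw [card_univ, Fintype.card_fin] at this
  omega

/-- The branch vertices of a subdivision of `K_{s,t}` cannot be separated by fewer than `s`
vertices. -/
theorem IsTopologicalMinor.exists_branch {s t : ℕ} (hst : s ≤ t) {G : SimpleGraph V}
    (h : IsTopologicalMinor (completeBipartiteGraph (Fin s) (Fin t)) G) :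
    ∃ f : Fin s ⊕ Fin t → V, Function.Injective f ∧ ∀ Z : Finset V, Z.card < s →
      ∀ a b, f a ∉ Z → f b ∉ Z → (avoid G Z).Reachable (f a) (f b) := by
  obtain ⟨S, f, P, hf, -, -, hbr, hint, -, -⟩ := h
  refine ⟨f, hf, fun Z hZ => ?_⟩
  have hwalk : ∀ {x y : V} (p : G.Walk x y), (∀ v ∈ p.support, v ∉ Z) →
      (avoid G Z).Reachable x y := by
    intro x y p
    induction p with
    | nil => exact fun _ => SimpleGraph.Reachable.refl _
    | cons hadj p ih =>
      intro hp
      refine (SimpleGraph.Adj.reachable (G := avoid G Z) ⟨hadj, hp _ (by simp), hp _ (by simp)⟩).trans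
        (ih fun v hv => hp v (by simp [hv]))
  have hadj : ∀ i j, (completeBipartiteGraph (Fin s) (Fin t)).Adj (.inl i) (.inr j) := by simp
  have hcommon : ∀ i j i' j' x, x ∈ (P _ _ (hadj i j)).support →
      x ∈ (P _ _ (hadj i' j')).support → (i, j) ≠ (i', j') →
      (x = f (.inl i) ∧ i = i') ∨ (x = f (.inr j) ∧ j = j') := by
    intro i j i' j' x hx hx' hne
    obtain ⟨w, rfl⟩ := hint _ _ (hadj i j) _ _ (hadj i' j') (by
      intro heq
      rcases Sym2.eq_iff.1 heq with ⟨h1, h2⟩ | ⟨h1, -⟩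
      · exact hne (by rw [Sum.inl_injective h1, Sum.inr_injective h2])
      · simp at h1) x hx hx'
    rcases hbr _ _ _ w hx with rfl | rfl <;> rcases hbr _ _ _ _ hx' with h1 | h1
    · exact Or.inl ⟨rfl, Sum.inl_injective h1⟩
    · simp at h1
    · simp at h1
    · exact Or.inr ⟨rfl, Sum.inr_injective h1⟩
  -- The stars of paths at the left branch vertices, without their right ends, are disjoint, so one
  -- of the `s` stars misses `Z`. Its centre will reach every branch vertex outside `Z`.
  obtain ⟨i₀, hi₀⟩ := exists_disjoint_of_card_lt hZ
    (fun i x => ∃ j, x ∈ (P _ _ (hadj i j)).support ∧ x ≠ f (.inr j)) (by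
      rintro i i' x ⟨j, hx, hxj⟩ ⟨j', hx', -⟩
      by_contra hne
      rcases hcommon i j i' j' x hx hx' (fun h => hne (Prod.mk.inj h).1) with ⟨-, h⟩ | ⟨h, -⟩
      · exact hne h
      · exact hxj h)
  have hright : ∀ j, f (.inr j) ∉ Z → (avoid G Z).Reachable (f (.inl i₀)) (f (.inr j)) := by
    intro j hj
    refine hwalk (P _ _ (hadj i₀ j)) fun v hv hvZ => hi₀ v hvZ ⟨j, hv, ?_⟩
    rintro rfl
    exact hj hvZ
  have hleft : ∀ i, f (.inl i) ∉ Z → (avoid G Z).Reachable (f (.inl i₀)) (f (.inl i)) := by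
    intro i hi
    -- The `t ≥ s` paths from `f (.inl i)` share only that vertex, so one of them misses `Z`.
    obtain ⟨j₀, hj₀⟩ := exists_disjoint_of_card_lt (hZ.trans_le hst)
      (fun j x => x ∈ (P _ _ (hadj i j)).support ∧ x ≠ f (.inl i)) (by
        rintro j j' x ⟨hx, hxi⟩ ⟨hx', -⟩
        by_contra hne
        rcases hcommon i j i j' x hx hx' (fun h => hne (Prod.mk.inj h).2) with ⟨h, -⟩ | ⟨-, h⟩
        · exact hxi h
        · exact hne h)
    have hZ' : ∀ v ∈ (P _ _ (hadj i j₀)).support, v ∉ Z := by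
      intro v hv hvZ
      refine hj₀ v hvZ ⟨hv, ?_⟩
      rintro rfl
      exact hi hvZ
    exact (hright j₀ (hZ' _ (SimpleGraph.Walk.end_mem_support _))).trans
      (hwalk _ hZ').symm
  have hall : ∀ a, f a ∉ Z → (avoid G Z).Reachable (f (.inl i₀)) (f a) := by
    rintro (i | j) h
    · exact hleft i h
    · exact hright j h
  exact fun a b ha hb => (hall a ha).symm.trans (hall b hb)

/-- The vertices of the rooted tree in which each vertex at height less than `s - 1` has `d + 1`
children. -/
abbrev TreeVertex (s d : ℕ) : Type u := ULift.{u} {l : List (Fin (d + 1)) // l.length < s}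

instance (s d : ℕ) : Finite (TreeVertex.{u} s d) := by
  have : Finite {l : List (Fin (d + 1)) // l.length < s} :=
    (List.finite_length_lt (Fin (d + 1)) s).to_subtype
  infer_instance

/-- The closure of a rooted tree: two vertices are adjacent if one is an ancestor of the other. -/
def treeClosure (s d : ℕ) : SimpleGraph (TreeVertex.{u} s d) where
  Adj x y := x ≠ y ∧ (x.down.1 <+: y.down.1 ∨ y.down.1 <+: x.down.1)
  symm := ⟨fun _ _ h => ⟨h.1.symm, h.2.symm⟩⟩
  loopless := ⟨fun _ h => h.1 rfl⟩

/-- Pairwise comparable vertices have distinct depths below `s`, so two of the `s + t` branch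
vertices are incomparable. Their common ancestors number fewer than `s` and separate them. -/
theorem treeClosure_free {s t d : ℕ} (hs : 1 ≤ s) (hst : s ≤ t) :
    ¬ IsTopologicalMinor (completeBipartiteGraph (Fin s) (Fin t)) (treeClosure.{u} s d) := by
  intro h
  obtain ⟨f, hf, hconn⟩ := h.exists_branch hst
  have := Fintype.ofFinite (TreeVertex.{u} s d)
  let ι : TreeVertex.{u} s d → List (Fin (d + 1)) := fun x => x.down.1
  have hι : ∀ x y, ι x = ι y → x = y := fun x y h => ULift.ext _ _ (Subtype.ext h)
  obtain ⟨a, b, hab, hba⟩ : ∃ a b, ¬ ι (f a) <+: ι (f b) ∧ ¬ ι (f b) <+: ι (f a) := by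
    by_contra hcon
    push Not at hcon
    have hinj : Function.Injective fun w => (⟨(ι (f w)).length, (f w).down.2⟩ : Fin s) := by
      intro w w' heq
      have hlen : (ι (f w)).length = (ι (f w')).length := Fin.mk.inj heq
      apply hf
      apply hι
      by_cases hp : ι (f w) <+: ι (f w')
      · exact hp.eq_of_length hlen
      · exact ((hcon w w' hp).eq_of_length hlen.symm).symm
    have := Fintype.card_le_of_injective _ hinj
    simp at this
    omega
  let Z : Finset (TreeVertex.{u} s d) := univ.filter fun z => ι z <+: ι (f a) ∧ ι z <+: ι (f b)
  have hmemZ : ∀ z, z ∈ Z ↔ ι z <+: ι (f a) ∧ ι z <+: ι (f b) := by intro z; simp [Z]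
  have hZ : Z.card < s := by
    refine lt_of_le_of_lt ?_ (f a).down.2
    rw [← card_range (f a).down.1.length]
    refine card_le_card_of_injOn (fun z => (ι z).length) (fun z hz => ?_) fun z hz z' hz' heq => ?_
    · obtain ⟨h1, h2⟩ := (hmemZ z).1 hz
      rw [coe_range, Set.mem_Iio]
      refine lt_of_le_of_ne h1.length_le fun heq => hab ?_
      rw [← h1.eq_of_length heq]
      exact h2
    · obtain ⟨h1, -⟩ := (hmemZ z).1 hz
      obtain ⟨h1', -⟩ := (hmemZ z').1 hz'
      exact hι z z' ((List.prefix_of_prefix_length_le h1 h1' (le_of_eq heq)).eq_of_length heq)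
  have hreach := hconn Z hZ a b (fun h => hab ((hmemZ _).1 h).2) (fun h => hba ((hmemZ _).1 h).1)
  -- `p x` says that `x` descends from an ancestor of `f a` that is not an ancestor of `f b`. An
  -- edge can leave this set only through a common ancestor, that is, through `Z`.
  let p : TreeVertex.{u} s d → Prop := fun x => ∃ w, w <+: ι (f a) ∧ w <+: ι x ∧ ¬ w <+: ι (f b)
  have hstep : ∀ x y, (avoid (treeClosure s d) Z).Adj x y → p x → p y := by
    rintro x y ⟨⟨-, hxy⟩, -, hy⟩ ⟨w, h1, h2, h3⟩
    rcases hxy with hxy | hxy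
    · exact ⟨w, h1, h2.trans hxy, h3⟩
    · rcases List.prefix_or_prefix_of_prefix h2 hxy with h4 | h4
      · exact ⟨w, h1, h4, h3⟩
      · exact ⟨ι y, h4.trans h1, List.prefix_rfl, fun h5 => hy ((hmemZ y).2 ⟨h4.trans h1, h5⟩)⟩
  have := eq_of_reachable (l := p) (fun x y hxy =>
    propext ⟨hstep x y hxy, hstep y x hxy.symm⟩) hreach
  obtain ⟨w, -, h2, h3⟩ : p (f b) := this ▸ ⟨ι (f a), List.prefix_rfl, List.prefix_rfl, hab⟩
  exact h3 h2

/-- Descend from the root. Some child subtree avoids the colour of the current vertex, which would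
otherwise have `d + 1` neighbours of its own colour. After `s - 1` steps the current vertex needs an
`s`-th colour. -/
theorem treeClosure_not_colourable {s d j : ℕ} (hj : j < s) :
    ¬ IsColourable (treeClosure.{u} s d) j d := by
  rintro ⟨c, hc⟩
  have key : ∀ k, k < s → ∃ (l : List (Fin (d + 1))) (C : Finset (Fin j)), l.length = k ∧
      C.card = k ∧ ∀ x : TreeVertex.{u} s d, l <+: x.down.1 → c x ∉ C := by
    intro k
    induction k with
    | zero => exact fun _ => ⟨[], ∅, rfl, rfl, by simp⟩
    | succ k ih =>
      intro hk
      obtain ⟨l, C, hl, hC, hlC⟩ := ih (by omega)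
      let x₀ : TreeVertex.{u} s d := ⟨l, by omega⟩
      have hx₀ : c x₀ ∉ C := hlC x₀ List.prefix_rfl
      obtain ⟨i, hi⟩ : ∃ i : Fin (d + 1), ∀ x : TreeVertex.{u} s d,
          (l ++ [i]) <+: x.down.1 → c x ≠ c x₀ := by
        by_contra hcon
        push Not at hcon
        choose x hx hxc using hcon
        have hinj : Function.Injective x := by
          intro i i' heq
          have h1 := hx i
          rw [heq] at h1
          have := (List.prefix_of_prefix_length_le h1 (hx i') (by simp)).eq_of_length (by simp)
          simpa using this
        have hsub : Set.range x ⊆ {y | (treeClosure.{u} s d).Adj x₀ y ∧ c y = c x₀} := by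
          rintro _ ⟨i, rfl⟩
          refine ⟨⟨fun heq => ?_, Or.inl ((List.prefix_append l [i]).trans (hx i))⟩, hxc i⟩
          have h1 := (hx i).length_le
          rw [← heq] at h1
          simp [x₀] at h1
        have h1 := (Set.encard_le_encard hsub).trans (hc x₀)
        rw [← Set.image_univ, hinj.encard_image, Set.encard_univ, ENat.card_eq_coe_fintype_card,
          Fintype.card_fin] at h1
        have h2 : d + 1 ≤ d := by exact_mod_cast h1
        omega
      refine ⟨l ++ [i], insert (c x₀) C, by simp [hl], by rw [card_insert_of_notMem hx₀, hC],
        fun x hx => ?_⟩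
      rw [mem_insert, not_or]
      exact ⟨hi x hx, hlC x ((List.prefix_append l [i]).trans hx)⟩
  obtain ⟨l, C, hl, hC, hlC⟩ := key (s - 1) (by omega)
  let x₀ : TreeVertex.{u} s d := ⟨l, by omega⟩
  have h1 := card_insert_of_notMem (hlC x₀ List.prefix_rfl)
  have h2 := card_le_univ (insert (c x₀) C)
  rw [Fintype.card_fin] at h2
  omega

end LowerBound

/-! ### Explicit bounds and the main theorem -/

theorem IsChoosable.isColourable {V : Type u} {G : SimpleGraph V} {k d : ℕ}
    (h : IsChoosable G k d) : IsColourable G k d := by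
  obtain ⟨c, -, hc⟩ := h (Fin k) (fun _ => univ) (by simp)
  exact ⟨c, hc⟩

/-- Graphs of average degree at least this contain a subdivision of `K_{s,t}`. -/
def denseBound (s t : ℕ) : ℕ :=
  2 * (24 * (2 * (s * t)) + 2) + 10 * (2 * (s * t) + (s + t))

/-- The defect for the choosability of graphs without `K_{s,t}` topological minors. -/
def defectBound (s t : ℕ) : ℕ :=
  denseBound s t * (denseBound s t + t * denseBound s t ^ (s - 1) + 1)

theorem isChoosable_defectBound {s t : ℕ} (hs : 1 ≤ s) {V : Type u} [Finite V]
    {G : SimpleGraph V} (hG : KstTopologicalMinorFree s t V G) :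
    IsChoosable G s (defectBound s t) := by
  have := Fintype.ofFinite V
  refine choosable_of_light hs fun H hH hdeg he => ?_
  refine exists_light_edge (t := t) (Γ := denseBound s t) hs (fun D hD W hW => ?_) ?_ hdeg he le_rfl
  · by_contra hcon
    exact not_nonempty_iff.2 hD
      (exists_model_of_dense (by omega) rfl rfl hW (not_lt.1 hcon))
  · rw [← not_nonempty_iff]
    rintro ⟨N⟩
    obtain ⟨N'⟩ := N.map_le hH
    exact hG N'.isTopologicalMinor

theorem isChoosable_of_free_one_one {V : Type u} [Finite V] {G : SimpleGraph V}
    (hG : KstTopologicalMinorFree 1 1 V G) : IsChoosable G 1 0 := by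
  have := Fintype.ofFinite V
  refine choosable_of_light le_rfl fun H hH _ ⟨a, b, hab⟩ => ?_
  obtain ⟨N⟩ := KstModel.of_common_nbrs (s := 1) (t := 1) (G := G) (S := {a}) (T := {b}) rfl
    le_rfl (by simpa using hH hab)
  exact absurd N.isTopologicalMinor hG

/-- The quadratic bound has constant at most `2 ^ 7`, which `2 ≤ t` turns into a power of `t`. The
next lemma absorbs its constant 4 in the same way. -/
theorem denseBound_le {s t : ℕ} (hst : s ≤ t) (ht : 2 ≤ t) : denseBound s t ≤ t ^ 9 := by
  have h1 : s * t ≤ t * t := Nat.mul_le_mul_right t hst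
  have h2 : 2 ^ 7 ≤ t ^ 7 := Nat.pow_le_pow_left ht 7
  have h3 : 2 * t ≤ t * t := Nat.mul_le_mul_right t ht
  calc denseBound s t ≤ 2 ^ 7 * (t * t) := by unfold denseBound; omega
    _ ≤ t ^ 7 * (t * t) := Nat.mul_le_mul_right _ h2
    _ = t ^ 9 := by ring

theorem defectBound_le {s t : ℕ} (hs : 1 ≤ s) (hst : s ≤ t) (ht : 2 ≤ t) :
    defectBound s t ≤ t ^ (20 * s) := by
  have hΓ := denseBound_le hst ht
  have ht1 : 1 ≤ t := by omega
  have h1 : t * denseBound s t ^ (s - 1) ≤ t ^ (9 * s) := by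
    calc t * denseBound s t ^ (s - 1) ≤ t * (t ^ 9) ^ (s - 1) := by gcongr
      _ = t ^ (1 + 9 * (s - 1)) := by rw [← pow_mul, pow_add, pow_one]
      _ ≤ t ^ (9 * s) := Nat.pow_le_pow_right ht1 (by omega)
  have h2 : t ^ 9 ≤ t ^ (9 * s) := Nat.pow_le_pow_right ht1 (by omega)
  have h3 : 1 ≤ t ^ (9 * s) := Nat.one_le_pow _ _ ht1
  have h4 : 2 ^ 2 ≤ t ^ 2 := Nat.pow_le_pow_left ht 2
  calc defectBound s t ≤ t ^ 9 * (2 ^ 2 * t ^ (9 * s)) := by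
        unfold defectBound
        refine Nat.mul_le_mul hΓ ?_
        omega
    _ ≤ t ^ 9 * (t ^ 2 * t ^ (9 * s)) := by gcongr
    _ = t ^ (9 + (2 + 9 * s)) := by rw [pow_add, pow_add]
    _ ≤ t ^ (20 * s) := Nat.pow_le_pow_right ht1 (by omega)

end

end DefectiveColouring

theorem mainTheorem3 :
    (∀ s t : ℕ, 1 ≤ s → s ≤ t →
      DefectiveColouring.IsDefectiveChromaticNumber
        (DefectiveColouring.KstTopologicalMinorFree.{u} s t) s ∧
      DefectiveColouring.IsDefectiveChoiceNumber
        (DefectiveColouring.KstTopologicalMinorFree.{u} s t) s) ∧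
    ∃ C : ℝ, 0 < C ∧ ∀ s t : ℕ, 1 ≤ s → s ≤ t →
      ∃ d : ℕ, (d : ℝ) ≤ (2 : ℝ) ^ (C * ((s : ℝ) * Real.log (t : ℝ))) ∧
        ∀ (V : Type u) [Finite V] (G : SimpleGraph V),
          DefectiveColouring.KstTopologicalMinorFree s t V G →
            DefectiveColouring.IsChoosable G s d := by
  open DefectiveColouring in
  refine ⟨fun s t hs hst => ⟨⟨⟨defectBound s t, fun V _ G hG =>
      (isChoosable_defectBound hs hG).isColourable⟩, ?_⟩,
    ⟨⟨defectBound s t, fun V _ G hG => isChoosable_defectBound hs hG⟩, ?_⟩⟩, ?_⟩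
  · rintro j ⟨d, hd⟩
    by_contra hj
    exact treeClosure_not_colourable (not_le.1 hj) (hd _ _ (treeClosure_free hs hst))
  · rintro j ⟨d, hd⟩
    by_contra hj
    exact treeClosure_not_colourable (not_le.1 hj)
      (hd _ _ (treeClosure_free hs hst)).isColourable
  · have hlog : 0 < Real.log 2 := Real.log_pos one_lt_two
    -- This `C` makes `2 ^ (C * (s * log t))` equal to `t ^ (20 * s)`.
    refine ⟨20 / Real.log 2, by positivity, fun s t hs hst => ?_⟩
    by_cases ht : 2 ≤ t
    · refine ⟨defectBound s t, ?_, fun V _ G hG => isChoosable_defectBound hs hG⟩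
      have ht0 : (0 : ℝ) < t := by exact_mod_cast (show 0 < t by omega)
      calc (defectBound s t : ℝ) ≤ (t : ℝ) ^ (20 * s) := by
            exact_mod_cast defectBound_le hs hst ht
        _ = (2 : ℝ) ^ (20 / Real.log 2 * ((s : ℝ) * Real.log (t : ℝ))) := by
            rw [Real.rpow_def_of_pos two_pos, ← Real.rpow_natCast, Real.rpow_def_of_pos ht0]
            congr 1
            push_cast
            field_simp
    -- Since `log 1 = 0`, the allowed defect is at most 1 and `defectBound` is too large; but graphs
    -- without K_{1,1} have no edges.
    · obtain rfl : t = 1 := by omega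
      obtain rfl : s = 1 := by omega
      exact ⟨0, by simp, fun V _ G hG => isChoosable_of_free_one_one hG⟩
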